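/- Let $\mathbb{S}^2\subset\mathbb{R}^3$ be the unit sphere with its round metric $g_0$, its Laplace–Beltrami operator $\Delta_{g_0}$ and its Riemannian volume $\operatorname{Vol}_{g_0}$ (of total mass $4\pi$). For an integer $l\ge 0$, let $E_l=\operatorname{Ker}(\Delta_{g_0}+l(l+1))$ be the space of complex-valued spherical harmonics of degree $l$; it has dimension $2l+1$. Let $\mathcal{B}_l$ be the set of orthonormal bases $b=(e_{-l},\ldots,e_l)$ of $E_l$ for the inner product of $L^2(\mathbb{S}^2,\operatorname{Vol}_{g_0})$. It is non-empty, and the choice of a reference basis $(e^0_j)_j$ identifies it with the unitary group $U(2l+1)$, a matrix $U$ corresponding to the basis with members $e_m=\sum_j U_{jm}e^0_j$. Let $\mathbb{P}_l$ be the probability measure on $\mathcal{B}_l$ that corresponds to the Haar probability measure on $U(2l+1)$ (it does not depend on the reference basis). Theorem. Let $a:\mathbb{S}^2\to\mathbb{C}$ be a continuous function. Then there exist constants $C_a>0$ and $c_a>0$, depending only on $a$, such that, for every integer $l\ge 0$, $$\mathbb{P}_l\left(\left\{b=(e_{-l},\ldots,e_l)\in\mathcal{B}_l:\ \sup_{-l\le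 m\le l}\left|\int_{\mathbb{S}^2}a|e_m|^2\,d\operatorname{Vol}_{g_0}-\frac{1}{\operatorname{Vol}_{g_0}(\mathbb{S}^2)}\int_{\mathbb{S}^2}a\,d\operatorname{Vol}_{g_0}\right|\ge l^{-\frac18}\right\}\right)\le C_a\,e^{-c_a\sqrt{l}}.$$ -/

import Mathlib

open MeasureTheory
open scoped ContDiff

/-- The unit sphere `S²` of Euclidean three-space, with its subspace topology. -/
abbrev S2 : Type := Metric.sphere (0 : EuclideanSpace ℝ (Fin 3)) 1

/-- The Riemannian volume (surface measure, of total mass `4π`) of the round sphere `S²`. -/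
noncomputable abbrev volS2 : Measure S2 :=
  (volume : Measure (EuclideanSpace ℝ (Fin 3))).toSphere

/-- The extension of a function on `S²` that is constant along rays, `x ↦ f (x / ‖x‖)`.
The value at the origin plays no role. -/
noncomputable def radialExtension (f : S2 → ℂ) (x : EuclideanSpace ℝ (Fin 3)) : ℂ :=
  if hx : x = 0 then 0
  else f ⟨‖x‖⁻¹ • x, by
    rw [mem_sphere_zero_iff_norm]
    exact norm_smul_inv_norm (𝕜 := ℝ) hx⟩

/-- `f` is a smooth function on the sphere: its extension constant along rays is smooth away from
the origin. -/
def IsSmoothS2 (f : S2 → ℂ) : Prop :=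
  ContDiffOn ℝ ∞ (radialExtension f) {0}ᶜ

/-- The Laplace–Beltrami operator of the round metric on `S²` applied to a smooth function `f`:
the restriction to `S²` of the Euclidean Laplacian of the extension of `f` constant along rays. -/
noncomputable def laplaceS2 (f : S2 → ℂ) (x : S2) : ℂ :=
  Laplacian.laplacian (radialExtension f) (x : EuclideanSpace ℝ (Fin 3))

theorem radialExtension_add (f g : S2 → ℂ) :
    radialExtension (f + g) = radialExtension f + radialExtension g := by
  funext x
  by_cases hx : x = 0 <;> simp [radialExtension, hx]

theorem radialExtension_smul (c : ℂ) (f : S2 → ℂ) :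
    radialExtension (c • f) = c • radialExtension f := by
  funext x
  by_cases hx : x = 0 <;> simp [radialExtension, hx]

theorem IsSmoothS2.contDiffAt {f : S2 → ℂ} (hf : IsSmoothS2 f) (x : S2) :
    ContDiffAt ℝ 2 (radialExtension f) (x : EuclideanSpace ℝ (Fin 3)) := by
  have hx : (x : EuclideanSpace ℝ (Fin 3)) ∈ ({0}ᶜ : Set (EuclideanSpace ℝ (Fin 3))) := by
    have h := x.2
    rw [mem_sphere_zero_iff_norm] at h
    intro h0
    rw [Set.mem_singleton_iff] at h0
    simp [h0] at h
  exact (ContDiffOn.contDiffAt hf (isOpen_compl_singleton.mem_nhds hx)).of_le (WithTop.coe_le_coe.2 le_top)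

/-- The eigenspace `E_l = Ker (Δ + l (l + 1))` of the Laplace–Beltrami operator on `S²`, i.e. the
space of complex-valued spherical harmonics of degree `l`. -/
noncomputable def sphericalHarmonics (l : ℕ) : Submodule ℂ C(S2, ℂ) where
  carrier := {f | IsSmoothS2 f ∧ ∀ x : S2, laplaceS2 f x + (l : ℂ) * ((l : ℂ) + 1) * f x = 0}
  zero_mem' := by
    have h0 : radialExtension (⇑(0 : C(S2, ℂ))) = fun _ => 0 := by
      funext x
      by_cases hx : x = 0 <;> simp [radialExtension, hx]
    refine ⟨?_, fun x => ?_⟩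
    · rw [IsSmoothS2, h0]
      exact contDiffOn_const
    · rw [laplaceS2, h0]
      simp
  add_mem' := by
    rintro f g ⟨hf, hf'⟩ ⟨hg, hg'⟩
    refine ⟨?_, fun x => ?_⟩
    · rw [IsSmoothS2, ContinuousMap.coe_add, radialExtension_add]
      exact ContDiffOn.add hf hg
    · have h := (hf.contDiffAt x).laplacian_add (hg.contDiffAt x)
      have h1 := hf' x
      have h2 := hg' x
      rw [laplaceS2] at h1 h2
      rw [laplaceS2, ContinuousMap.coe_add, radialExtension_add, h, Pi.add_apply]
      linear_combination h1 + h2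
  smul_mem' := by
    rintro c f ⟨hf, hf'⟩
    refine ⟨?_, fun x => ?_⟩
    · rw [IsSmoothS2, ContinuousMap.coe_smul, radialExtension_smul]
      exact ContDiffOn.const_smul c hf
    · have h := InnerProductSpace.laplacian_smul c (hf.contDiffAt x)
      have h1 := hf' x
      rw [laplaceS2] at h1
      rw [laplaceS2, ContinuousMap.coe_smul, radialExtension_smul, h, Pi.smul_apply]
      simp only [smul_eq_mul]
      linear_combination c * h1

/-- `e` is an orthonormal basis of `E_l`, indexed by `2 l + 1` labels, for the inner product of
`L²(S²)`. -/
def IsHarmonicONB (l : ℕ) (e : Fin (2 * l + 1) → C(S2, ℂ)) : Prop :=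
  Submodule.span ℂ (Set.range e) = sphericalHarmonics l ∧
    ∀ m n, ∫ x, starRingEnd ℂ (e m x) * e n x ∂volS2 = if m = n then 1 else 0

/-- The set `B_l` of orthonormal bases of `E_l`. -/
def HarmonicONB (l : ℕ) : Type := {e : Fin (2 * l + 1) → C(S2, ℂ) // IsHarmonicONB l e}

/-- `B_l` carries the topology of uniform convergence of the `2 l + 1` basis functions. -/
noncomputable instance (l : ℕ) : TopologicalSpace (HarmonicONB l) :=
  inferInstanceAs (TopologicalSpace {e : Fin (2 * l + 1) → C(S2, ℂ) // IsHarmonicONB l e})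

noncomputable instance (l : ℕ) : MeasurableSpace (HarmonicONB l) := borel _

instance (l : ℕ) : BorelSpace (HarmonicONB l) := ⟨rfl⟩

/-- The unitary group `U(2 l + 1)`, with its usual topology and Borel sets. -/
abbrev UnitaryS2 (l : ℕ) : Type := Matrix.unitaryGroup (Fin (2 * l + 1)) ℂ

noncomputable instance (l : ℕ) : MeasurableSpace (UnitaryS2 l) := borel _

instance (l : ℕ) : BorelSpace (UnitaryS2 l) := ⟨rfl⟩

instance (l : ℕ) : CompactSpace (UnitaryS2 l) := by
  refine (isCompact_iff_compactSpace (s := SetLike.coe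
    (unitary (Matrix (Fin (2 * l + 1)) (Fin (2 * l + 1)) ℂ)))).mp ?_
  have hK : IsCompact (Set.pi Set.univ fun _ : Fin (2 * l + 1) =>
      Set.pi Set.univ fun _ : Fin (2 * l + 1) => Metric.closedBall (0 : ℂ) 1) :=
    isCompact_univ_pi fun _ => isCompact_univ_pi fun _ => isCompact_closedBall _ _
  refine hK.of_isClosed_subset
    (isClosed_unitary (R := Matrix (Fin (2 * l + 1)) (Fin (2 * l + 1)) ℂ)) ?_
  intro U hU i _ j _
  rw [mem_closedBall_zero_iff]
  exact entry_norm_bound_of_unitary hU i j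

/-- The Haar probability measure on `U(2 l + 1)`. -/
noncomputable def haarUnitary (l : ℕ) : Measure (UnitaryS2 l) := Measure.haarMeasure ⊤

instance (l : ℕ) : IsProbabilityMeasure (haarUnitary l) :=
  ⟨by simpa [haarUnitary] using
    Measure.haarMeasure_self (K₀ := (⊤ : TopologicalSpace.PositiveCompacts (UnitaryS2 l)))⟩

/-- The family `e U`, whose `m`-th member is `∑ j, U j m • e j`. -/
noncomputable def rotateFamily {l : ℕ} (e : Fin (2 * l + 1) → C(S2, ℂ)) (U : UnitaryS2 l) :
    Fin (2 * l + 1) → C(S2, ℂ) :=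
  fun m => ∑ j, (U : Matrix (Fin (2 * l + 1)) (Fin (2 * l + 1)) ℂ) j m • e j

theorem rotateFamily_mul {l : ℕ} (e : Fin (2 * l + 1) → C(S2, ℂ)) (U V : UnitaryS2 l) :
    rotateFamily e (U * V) = rotateFamily (rotateFamily e U) V := by
  funext m
  ext x
  simp only [rotateFamily, Matrix.UnitaryGroup.mul_val, Matrix.mul_apply,
    ContinuousMap.sum_apply, ContinuousMap.smul_apply, smul_eq_mul, Finset.sum_mul,
    Finset.mul_sum]
  rw [Finset.sum_comm]
  refine Finset.sum_congr rfl fun i _ => Finset.sum_congr rfl fun j _ => ?_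
  ring

theorem rotateFamily_one {l : ℕ} (e : Fin (2 * l + 1) → C(S2, ℂ)) :
    rotateFamily e (1 : UnitaryS2 l) = e := by
  funext m
  ext x
  simp only [rotateFamily, Matrix.UnitaryGroup.one_val, Matrix.one_apply,
    ContinuousMap.sum_apply, ContinuousMap.smul_apply, smul_eq_mul]
  simp

theorem span_rotateFamily_le {l : ℕ} (e : Fin (2 * l + 1) → C(S2, ℂ)) (U : UnitaryS2 l) :
    Submodule.span ℂ (Set.range (rotateFamily e U)) ≤ Submodule.span ℂ (Set.range e) := by
  rw [Submodule.span_le]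
  rintro _ ⟨m, rfl⟩
  exact Submodule.sum_mem _ fun j _ =>
    Submodule.smul_mem _ _ (Submodule.subset_span (Set.mem_range_self j))

theorem integrable_conj_mul (f g : C(S2, ℂ)) :
    Integrable (fun x => starRingEnd ℂ (f x) * g x) volS2 :=
  Continuous.integrable_of_hasCompactSupport (by fun_prop)
    (HasCompactSupport.of_compactSpace _)

theorem IsHarmonicONB.rotate {l : ℕ} {e : Fin (2 * l + 1) → C(S2, ℂ)} (he : IsHarmonicONB l e)
    (U : UnitaryS2 l) : IsHarmonicONB l (rotateFamily e U) := by
  refine ⟨?_, fun m n => ?_⟩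
  · rw [← he.1]
    refine le_antisymm (span_rotateFamily_le e U) ?_
    have h := span_rotateFamily_le (rotateFamily e U) U⁻¹
    rwa [← rotateFamily_mul, mul_inv_cancel, rotateFamily_one] at h
  · set A : Matrix (Fin (2 * l + 1)) (Fin (2 * l + 1)) ℂ := U.1 with hA
    have h1 : ∀ x, starRingEnd ℂ (rotateFamily e U m x) * rotateFamily e U n x =
        ∑ i, ∑ j, (starRingEnd ℂ (A i m) * A j n) * (starRingEnd ℂ (e i x) * e j x) := by
      intro x
      simp only [rotateFamily, ContinuousMap.sum_apply, ContinuousMap.smul_apply, smul_eq_mul,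
        map_sum, map_mul, Finset.sum_mul_sum, ← hA]
      refine Finset.sum_congr rfl fun i _ => Finset.sum_congr rfl fun j _ => ?_
      ring
    simp only [h1]
    rw [integral_finsetSum _ fun i _ => integrable_finsetSum _ fun j _ =>
      (integrable_conj_mul (e i) (e j)).const_mul _]
    have h2 : ∀ i, ∫ x, ∑ j, (starRingEnd ℂ (A i m) * A j n) *
        (starRingEnd ℂ (e i x) * e j x) ∂volS2 = starRingEnd ℂ (A i m) * A i n := by
      intro i
      rw [integral_finsetSum _ fun j _ => (integrable_conj_mul (e i) (e j)).const_mul _]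
      simp only [integral_const_mul, he.2]
      simp
    simp only [h2]
    have h3 : (star A * A) m n = (1 : Matrix (Fin (2 * l + 1)) (Fin (2 * l + 1)) ℂ) m n := by
      rw [Matrix.mem_unitaryGroup_iff'.1 U.2]
    rw [Matrix.mul_apply, Matrix.one_apply] at h3
    simpa [Matrix.star_apply] using h3

/-- The identification of `U(2 l + 1)` with `B_l` given by a reference basis `b₀`: the matrix `U`
corresponds to the basis whose `m`-th element is `∑ j, U j m • b₀ j`. -/
noncomputable def HarmonicONB.rotate {l : ℕ} (b₀ : HarmonicONB l) (U : UnitaryS2 l) : HarmonicONB l :=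
  ⟨rotateFamily b₀.1 U, b₀.2.rotate U⟩

theorem HarmonicONB.continuous_rotate {l : ℕ} (b₀ : HarmonicONB l) : Continuous b₀.rotate := by
  refine Continuous.subtype_mk ?_ _
  refine continuous_pi fun m => continuous_finsetSum _ fun j _ => ?_
  have h : Continuous fun U : UnitaryS2 l => U.1 := continuous_subtype_val
  exact (h.matrix_elem j m).smul continuous_const

/-- The Haar probability measure on `B_l`, transported from `U(2 l + 1)` by means of a reference
basis `b₀` (as Haar measure is bi-invariant, it does not depend on `b₀`). -/
noncomputable def haarONB {l : ℕ} (b₀ : HarmonicONB l) : Measure (HarmonicONB l) :=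
  (haarUnitary l).map b₀.rotate

instance {l : ℕ} (b₀ : HarmonicONB l) : IsProbabilityMeasure (haarONB b₀) :=
  Measure.isProbabilityMeasure_map b₀.continuous_rotate.measurable.aemeasurable

/-!
Realize the sphere in `ℝ³`. The restrictions of homogeneous polynomials of degree `k` split
orthogonally into those of degree `k - 2` and a complement of dimension `2 k + 1`; Green's formula
shows that this complement consists of eigenfunctions, and the density of polynomials that there
are no others. So `E_l` has orthonormal bases with `2 l + 1` members. By invariance under rotations,
`∑ |e_m|²` is constant, and therefore the compression of the multiplication by `a - ⨍ a` to `E_l`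
is a matrix `A` of trace `0` and norm at most `2 ‖a‖`.

A member of a random basis is a column `u` of a Haar unitary of size `n = 2 l + 1`, and the
quantity to estimate is `u* A u`. For a complex Gaussian vector `v`, the direction of `v` is
distributed as `u` and is independent of the length of `v`. Jensen's inequality in the length thus
bounds the moment `E exp (n t u* H u)`, for Hermitian `H`, by the Gaussian integral of
`exp (-v* (1 - t H) v)`, that is by `det (1 - t H)⁻¹`. When `H` has trace `0`, this is at most
`exp (n t² ‖H‖²)`, and the Chernoff bound gives `P (u* H u ≥ s) ≤ exp (-n s² / (4 ‖H‖²))`. With `s`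
of order `l ^ (-1/8)` the exponent is of order `l ^ (3/4)`, which absorbs the union bound over the
`2 l + 1` columns.
-/

section ToSphere

open Set Measure Pointwise

variable {E : Type*} [NormedAddCommGroup E] [NormedSpace ℝ E]

/-- The map of the unit sphere to itself induced by a linear isometry. -/
def sphereMap (R : E ≃ₗᵢ[ℝ] E) : C(Metric.sphere (0 : E) 1, Metric.sphere (0 : E) 1) where
  toFun x := ⟨R x, by rw [mem_sphere_zero_iff_norm, R.norm_map, norm_eq_of_mem_sphere]⟩

@[simp]
theorem coe_sphereMap (R : E ≃ₗᵢ[ℝ] E) (x : Metric.sphere (0 : E) 1) :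
    (sphereMap R x : E) = R x := rfl

variable [MeasurableSpace E] [BorelSpace E]

theorem measurePreserving_sphereMap {μ : Measure E} {R : E ≃ₗᵢ[ℝ] E}
    (hR : MeasurePreserving R μ μ) : MeasurePreserving (sphereMap R) μ.toSphere μ.toSphere := by
  refine ⟨(sphereMap R).continuous.measurable, ext fun s hs => ?_⟩
  have hs' := (sphereMap R).continuous.measurable hs
  have hcone : Ioo (0 : ℝ) 1 • ((↑) '' (sphereMap R ⁻¹' s) : Set E) =
      R ⁻¹' (Ioo (0 : ℝ) 1 • ((↑) '' s)) := by
    ext x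
    simp only [mem_smul, mem_image, mem_preimage]
    constructor
    · rintro ⟨r, hr, _, ⟨y, hy, rfl⟩, rfl⟩
      exact ⟨r, hr, _, ⟨_, hy, rfl⟩, by simp⟩
    · rintro ⟨r, hr, _, ⟨y, hy, rfl⟩, hx⟩
      have hy' : sphereMap R (sphereMap R.symm y) = y := by ext1; simp
      refine ⟨r, hr, _, ⟨sphereMap R.symm y, by rwa [hy'], rfl⟩, R.injective ?_⟩
      simp [hx]
  rw [map_apply (sphereMap R).continuous.measurable hs, toSphere_apply' _ hs',
    toSphere_apply' _ hs, hcone,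
    hR.measure_preimage_emb R.toHomeomorph.measurableEmbedding]

variable [FiniteDimensional ℝ E] [Nontrivial E]

theorem integral_eq_radial_mul_integral_toSphere (μ : Measure E) [μ.IsAddHaarMeasure]
    {𝕜 : Type*} [RCLike 𝕜] {F : E → 𝕜} {h : ℝ → 𝕜} {f : Metric.sphere (0 : E) 1 → 𝕜}
    (hF : ∀ r > 0, ∀ x : Metric.sphere (0 : E) 1, F (r • (x : E)) = h r * f x) :
    ∫ x, F x ∂μ =
      (∫ r in Ioi (0 : ℝ), (r ^ (Module.finrank ℝ E - 1)) • h r) * ∫ x, f x ∂μ.toSphere := by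
  calc
    ∫ x, F x ∂μ = ∫ x : ({(0)}ᶜ : Set E), F x ∂(μ.comap (↑)) := by
      rw [integral_subtype_comap (measurableSet_singleton _).compl F, restrict_compl_singleton]
    _ = ∫ x, f x.1 * h x.2 ∂μ.toSphere.prod (.volumeIoiPow (Module.finrank ℝ E - 1)) := by
      rw [← μ.measurePreserving_homeomorphUnitSphereProd.integral_comp
        (Homeomorph.measurableEmbedding _)]
      refine integral_congr_ae (.of_forall fun x => ?_)
      obtain ⟨y, rfl⟩ := (homeomorphUnitSphereProd E).symm.surjective x
      simp only [Homeomorph.apply_symm_apply, homeomorphUnitSphereProd_symm_apply_coe]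
      rw [hF _ y.2.2, mul_comm]
    _ = (∫ x, f x ∂μ.toSphere) * ∫ r : Ioi (0 : ℝ), h r ∂.volumeIoiPow _ :=
      integral_prod_mul f fun r : Ioi (0 : ℝ) => h r
    _ = _ := by
      rw [mul_comm]
      congr 1
      simp only [volumeIoiPow, ENNReal.ofReal]
      rw [integral_withDensity_eq_integral_smul (measurable_subtype_coe.pow_const _).real_toNNReal,
        integral_subtype_comap measurableSet_Ioi fun r : ℝ ↦
          Real.toNNReal (r ^ (Module.finrank ℝ E - 1)) • h r]
      refine setIntegral_congr_fun measurableSet_Ioi fun r hr => ?_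
      simp only [NNReal.smul_def, Real.coe_toNNReal _ (pow_nonneg (le_of_lt hr.out) _)]

end ToSphere

section RadialCutoff

variable {E : Type*} [NormedAddCommGroup E]

variable {β : Type*} [Zero β] {ψ : ℝ → β}

theorem hasCompactSupport_comp_sq_norm [ProperSpace E] (hψ : HasCompactSupport ψ) :
    HasCompactSupport fun x : E => ψ (‖x‖ ^ 2) := by
  have hlim : Filter.Tendsto (fun x : E => ‖x‖ ^ 2) (.cocompact _) (.cocompact ℝ) :=
    ((Filter.tendsto_pow_atTop two_ne_zero).comp tendsto_norm_cocompact_atTop).mono_right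
      atTop_le_cocompact
  rw [hasCompactSupport_iff_eventuallyEq, Filter.coclosedCompact_eq_cocompact] at hψ ⊢
  exact hlim.eventually hψ

theorem ne_zero_of_mem_tsupport_comp_sq_norm {x : E} (h0 : (0 : ℝ) ∉ tsupport ψ)
    (hx : x ∈ tsupport fun y : E => ψ (‖y‖ ^ 2)) : x ≠ 0 := by
  have hsub : (tsupport fun y : E => ψ (‖y‖ ^ 2)) ⊆ (fun y => ‖y‖ ^ 2) ⁻¹' tsupport ψ :=
    closure_minimal (fun y hy => subset_tsupport ψ hy)
      ((isClosed_tsupport ψ).preimage (by fun_prop))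
  rintro rfl
  exact h0 (by simpa using hsub hx)

theorem integral_Ioi_comp_sq_pos {ψ : ℝ → ℝ} (hψ : Continuous ψ) (hc : HasCompactSupport ψ)
    (hnonneg : ∀ t, 0 ≤ ψ t) (hone : ψ 1 ≠ 0) : 0 < ∫ r in Set.Ioi (0 : ℝ), ψ (r ^ 2) := by
  have hpos : 0 < ∫ r, ψ (|r| ^ 2) :=
    (hψ.comp (by fun_prop)).integral_pos_of_hasCompactSupport_nonneg_nonzero
      (hasCompactSupport_comp_sq_norm hc) (fun r => hnonneg _) (x := 1) (by simpa using hone)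
  rw [integral_comp_abs (f := fun r => ψ (r ^ 2))] at hpos
  linarith

end RadialCutoff

section Laplacian

open InnerProductSpace
open scoped Laplacian

variable {E : Type*} [NormedAddCommGroup E] [InnerProductSpace ℝ E]

theorem fderiv_ofReal_comp_sq_norm {ψ : ℝ → ℝ} {x : E} (hψ : DifferentiableAt ℝ ψ (‖x‖ ^ 2))
    (v : E) :
    fderiv ℝ (fun y => (ψ (‖y‖ ^ 2) : ℂ)) x v =
      (2 * deriv ψ (‖x‖ ^ 2) * inner ℝ x v : ℝ) := by
  have h := (Complex.ofRealCLM.hasFDerivAt (x := ψ (‖x‖ ^ 2))).comp x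
    (hψ.hasDerivAt.comp_hasFDerivAt x (hasStrictFDerivAt_norm_sq x).hasFDerivAt)
  rw [show (fun y => (ψ (‖y‖ ^ 2) : ℂ)) = Complex.ofRealCLM ∘ (ψ ∘ fun y => ‖y‖ ^ 2) from rfl,
    h.fderiv]
  simp only [ContinuousLinearMap.comp_apply, smul_apply, Complex.ofRealCLM_apply,
    innerSL_apply_apply, smul_eq_mul, nsmul_eq_mul, Nat.cast_ofNat]
  ring_nf

variable {F : Type*} [NormedAddCommGroup F] [NormedSpace ℝ F]

theorem fderiv_self_eq_zero_of_forall_pos_smul {f : E → F} {x : E} (hf : DifferentiableAt ℝ f x)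
    (hr : ∀ r : ℝ, 0 < r → f (r • x) = f x) : fderiv ℝ f x x = 0 := by
  have hray : HasDerivAt (fun r : ℝ => r • x) x 1 := by
    simpa using (hasDerivAt_id (1 : ℝ)).smul_const x
  have hcomp : HasDerivAt (f ∘ fun r : ℝ => r • x) (fderiv ℝ f x x) 1 :=
    HasFDerivAt.comp_hasDerivAt 1 (by rw [one_smul]; exact hf.hasFDerivAt) hray
  have hconst : HasDerivAt (f ∘ fun r : ℝ => r • x) 0 1 := by
    refine (hasDerivAt_const (1 : ℝ) (f x)).congr_of_eventuallyEq ?_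
    filter_upwards [lt_mem_nhds (zero_lt_one' ℝ)] with r hr0 using hr r hr0
  exact hcomp.unique hconst

theorem fderiv_fderiv_comp_continuousLinearEquiv (f : E → F) (L : E ≃L[ℝ] E) (x v w : E) :
    fderiv ℝ (fderiv ℝ (f ∘ L)) x v w = fderiv ℝ (fderiv ℝ f) (L x) (L v) (L w) := by
  have h : fderiv ℝ (f ∘ L) =
      (L.arrowCongr (.refl ℝ F)).symm ∘ (fderiv ℝ f ∘ L) := by
    funext y
    rw [L.comp_right_fderiv]
    ext z
    simp
  rw [h, ContinuousLinearEquiv.comp_fderiv, L.comp_right_fderiv]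
  simp

variable [FiniteDimensional ℝ E]

theorem laplacian_comp_linearIsometryEquiv (f : E → F) (R : E ≃ₗᵢ[ℝ] E) (x : E) :
    Δ (f ∘ R) x = Δ f (R x) := by
  rw [laplacian_eq_iteratedFDeriv_stdOrthonormalBasis,
    laplacian_eq_iteratedFDeriv_orthonormalBasis f ((stdOrthonormalBasis ℝ E).map R)]
  simp only [iteratedFDeriv_two_apply]
  exact Finset.sum_congr rfl fun i _ =>
    fderiv_fderiv_comp_continuousLinearEquiv f R.toContinuousLinearEquiv x _ _

theorem laplacian_comp_smul (f : E → F) (c : ℝ) (x : E) :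
    Δ (fun y => f (c • y)) x = c ^ 2 • Δ f (c • x) := by
  rcases eq_or_ne c 0 with rfl | hc
  · simp [laplacian_const]
  simp only [laplacian_eq_iteratedFDeriv_stdOrthonormalBasis, iteratedFDeriv_two_apply,
    Finset.smul_sum]
  refine Finset.sum_congr rfl fun i _ =>
    (fderiv_fderiv_comp_continuousLinearEquiv f
      (ContinuousLinearEquiv.smulLeft (Units.mk0 c hc)) x _ _).trans ?_
  simp [Units.smul_def, smul_smul, sq]

end Laplacian

section PartialDeriv

open scoped Laplacian

variable {ι : Type*} [DecidableEq ι]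

/-- The `i`-th partial derivative of a complex-valued function of real variables. -/
noncomputable def partialDeriv (i : ι) (F : EuclideanSpace ℝ ι → ℂ) (x : EuclideanSpace ℝ ι) : ℂ :=
  fderiv ℝ F x (EuclideanSpace.single i 1)

variable {F G : EuclideanSpace ℝ ι → ℂ} {x : EuclideanSpace ℝ ι}

theorem partialDeriv_congr (h : F =ᶠ[nhds x] G) (i : ι) :
    partialDeriv i F x = partialDeriv i G x := by
  simp only [partialDeriv, h.fderiv_eq]

variable [Fintype ι]

theorem laplacian_eq_sum_partialDeriv (hF : ContDiffAt ℝ 2 F x) :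
    Δ F x = ∑ i, partialDeriv i (partialDeriv i F) x := by
  rw [InnerProductSpace.laplacian_eq_iteratedFDeriv_orthonormalBasis F
    (EuclideanSpace.basisFun ι ℝ)]
  refine Finset.sum_congr rfl fun i _ => ?_
  have hd : DifferentiableAt ℝ (fderiv ℝ F) x :=
    (hF.fderiv_right (m := 1) (by norm_num)).differentiableAt one_ne_zero
  simp [iteratedFDeriv_two_apply, show partialDeriv i F = fun y => fderiv ℝ F y _ from rfl,
    partialDeriv, fderiv_clm_apply hd]

theorem sum_coord_mul_partialDeriv (F : EuclideanSpace ℝ ι → ℂ) (x : EuclideanSpace ℝ ι) :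
    ∑ i, (x i : ℂ) * partialDeriv i F x = fderiv ℝ F x x := by
  conv_rhs => arg 2; rw [← (EuclideanSpace.basisFun ι ℝ).sum_repr x]
  simp [partialDeriv]

theorem contDiffAt_partialDeriv {m n : ℕ∞ω} (hF : ContDiffAt ℝ n F x)
    (hmn : m + 1 ≤ n) (i : ι) : ContDiffAt ℝ m (partialDeriv i F) x :=
  (hF.fderiv_right hmn).clm_apply contDiffAt_const

theorem contDiff_partialDeriv {m n : ℕ∞ω} (hF : ContDiff ℝ n F) (hmn : m + 1 ≤ n)
    (i : ι) : ContDiff ℝ m (partialDeriv i F) :=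
  (hF.fderiv_right hmn).clm_apply contDiff_const

theorem partialDeriv_fun_add (hF : DifferentiableAt ℝ F x) (hG : DifferentiableAt ℝ G x) (i : ι) :
    partialDeriv i (fun y => F y + G y) x = partialDeriv i F x + partialDeriv i G x := by
  simp only [partialDeriv, fderiv_fun_add hF hG, add_apply]

theorem partialDeriv_fun_sub (hF : DifferentiableAt ℝ F x) (hG : DifferentiableAt ℝ G x) (i : ι) :
    partialDeriv i (fun y => F y - G y) x = partialDeriv i F x - partialDeriv i G x := by
  simp only [partialDeriv, fderiv_fun_sub hF hG, sub_apply]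

theorem partialDeriv_fun_mul (hF : DifferentiableAt ℝ F x) (hG : DifferentiableAt ℝ G x) (i : ι) :
    partialDeriv i (fun y => F y * G y) x =
      F x * partialDeriv i G x + partialDeriv i F x * G x := by
  simp only [partialDeriv, fderiv_fun_mul hF hG, add_apply,
    smul_apply, smul_eq_mul, mul_comm]

theorem partialDeriv_ofReal_comp_sq_norm {ψ : ℝ → ℝ} (hψ : DifferentiableAt ℝ ψ (‖x‖ ^ 2)) (i : ι) :
    partialDeriv i (fun y => (ψ (‖y‖ ^ 2) : ℂ)) x = 2 * deriv ψ (‖x‖ ^ 2) * x i := by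
  rw [partialDeriv, fderiv_ofReal_comp_sq_norm hψ, EuclideanSpace.inner_single_right]
  simp

theorem integral_partialDeriv_eq_zero (hF : ContDiff ℝ 1 F) (hc : HasCompactSupport F) (i : ι) :
    ∫ x, partialDeriv i F x = 0 := by
  have hint : Integrable (partialDeriv i F) :=
    (contDiff_partialDeriv hF (m := 0) (by norm_num) i).continuous.integrable_of_hasCompactSupport
      (hc.fderiv_apply ℝ _)
  have h := integral_mul_fderiv_eq_neg_fderiv_mul_of_integrable (μ := volume)
    (f := fun _ => (1 : ℂ)) (g := F) (v := EuclideanSpace.single i 1)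
    (by simp) (by simp only [one_mul]; exact hint)
    (by simpa only [one_mul] using hF.continuous.integrable_of_hasCompactSupport hc)
    (fun _ _ => differentiableAt_const _) fun x _ => hF.differentiable one_ne_zero x
  simpa [partialDeriv] using h

/-- The divergence of a complex vector field on Euclidean space. -/
noncomputable def divergence (V : ι → EuclideanSpace ℝ ι → ℂ) (x : EuclideanSpace ℝ ι) : ℂ :=
  ∑ i, partialDeriv i (V i) x

theorem divergence_fun_mul {η : EuclideanSpace ℝ ι → ℂ} {V : ι → EuclideanSpace ℝ ι → ℂ}
    (hη : DifferentiableAt ℝ η x) (hV : ∀ i, DifferentiableAt ℝ (V i) x) :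
    divergence (fun i y => η y * V i y) x =
      η x * divergence V x + ∑ i, partialDeriv i η x * V i x := by
  simp only [divergence, partialDeriv_fun_mul hη (hV _), Finset.sum_add_distrib, Finset.mul_sum]

theorem integral_divergence_eq_zero {V : ι → EuclideanSpace ℝ ι → ℂ}
    (hV : ∀ i, ContDiff ℝ 1 (V i)) (hc : ∀ i, HasCompactSupport (V i)) :
    ∫ x, divergence V x = 0 := by
  simp only [divergence]
  rw [integral_finsetSum]
  · exact Finset.sum_eq_zero fun i _ => integral_partialDeriv_eq_zero (hV i) (hc i) i
  · exact fun i _ => (contDiff_partialDeriv (hV i) (m := 0) (by norm_num)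
      i).continuous.integrable_of_hasCompactSupport ((hc i).fderiv_apply ℝ _)

/-- The vector field `G ∇F - F ∇G` of Green's second identity. -/
noncomputable def greenField (F G : EuclideanSpace ℝ ι → ℂ) (i : ι) (x : EuclideanSpace ℝ ι) : ℂ :=
  G x * partialDeriv i F x - F x * partialDeriv i G x

theorem contDiffAt_greenField {m n : ℕ∞ω} (hF : ContDiffAt ℝ n F x)
    (hG : ContDiffAt ℝ n G x) (hmn : m + 1 ≤ n) (i : ι) : ContDiffAt ℝ m (greenField F G i) x :=
  have hle : m ≤ n := le_self_add.trans hmn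
  ((hG.of_le hle).mul (contDiffAt_partialDeriv hF hmn i)).sub
    ((hF.of_le hle).mul (contDiffAt_partialDeriv hG hmn i))

theorem divergence_greenField (hF : ContDiffAt ℝ 2 F x) (hG : ContDiffAt ℝ 2 G x) :
    divergence (greenField F G) x = G x * Δ F x - F x * Δ G x := by
  have hF₀ := hF.differentiableAt two_ne_zero
  have hG₀ := hG.differentiableAt two_ne_zero
  have hF₁ i := (contDiffAt_partialDeriv (m := 1) hF (by norm_num) i).differentiableAt one_ne_zero
  have hG₁ i := (contDiffAt_partialDeriv (m := 1) hG (by norm_num) i).differentiableAt one_ne_zero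
  rw [laplacian_eq_sum_partialDeriv hF, laplacian_eq_sum_partialDeriv hG, Finset.mul_sum,
    Finset.mul_sum, ← Finset.sum_sub_distrib]
  refine Finset.sum_congr rfl fun i _ => ?_
  refine (partialDeriv_fun_sub (hG₀.fun_mul (hF₁ i)) (hF₀.fun_mul (hG₁ i)) i).trans ?_
  rw [partialDeriv_fun_mul hG₀ (hF₁ i), partialDeriv_fun_mul hF₀ (hG₁ i)]
  ring

theorem sum_coord_mul_greenField (F G : EuclideanSpace ℝ ι → ℂ) (x : EuclideanSpace ℝ ι) :
    ∑ i, (x i : ℂ) * greenField F G i x = G x * fderiv ℝ F x x - F x * fderiv ℝ G x x := by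
  simp only [← sum_coord_mul_partialDeriv, Finset.mul_sum, ← Finset.sum_sub_distrib, greenField]
  exact Finset.sum_congr rfl fun i _ => by ring

theorem divergence_cutoff_greenField {ψ : ℝ → ℝ} (hψ : DifferentiableAt ℝ ψ (‖x‖ ^ 2))
    (hF : ContDiffAt ℝ 2 F x) (hG : ContDiffAt ℝ 2 G x)
    (hF₀ : fderiv ℝ F x x = 0) (hG₀ : fderiv ℝ G x x = 0) :
    divergence (fun i y => (ψ (‖y‖ ^ 2) : ℂ) * greenField F G i y) x =
      ψ (‖x‖ ^ 2) * (G x * Δ F x - F x * Δ G x) := by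
  have hη : DifferentiableAt ℝ (fun y : EuclideanSpace ℝ ι => (ψ (‖y‖ ^ 2) : ℂ)) x :=
    Complex.ofRealCLM.differentiableAt.comp x
      (hψ.comp x (f := fun y => ‖y‖ ^ 2) (differentiableAt_id.norm_sq ℝ))
  rw [divergence_fun_mul hη fun i =>
      (contDiffAt_greenField (m := 1) hF hG (by norm_num) i).differentiableAt one_ne_zero,
    divergence_greenField hF hG, add_eq_left]
  simp only [partialDeriv_ofReal_comp_sq_norm hψ, mul_assoc, ← Finset.mul_sum,
    sum_coord_mul_greenField, hF₀, hG₀, mul_zero, sub_zero]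

omit [DecidableEq ι] in
theorem integral_cutoff_mul_laplacian_sub_eq_zero {ψ : ℝ → ℝ} (hψ : ContDiff ℝ 1 ψ)
    (hc : HasCompactSupport ψ) (h0 : (0 : ℝ) ∉ tsupport ψ)
    (hF : ∀ x ≠ 0, ContDiffAt ℝ 2 F x) (hG : ∀ x ≠ 0, ContDiffAt ℝ 2 G x)
    (hF₀ : ∀ x ≠ 0, fderiv ℝ F x x = 0) (hG₀ : ∀ x ≠ 0, fderiv ℝ G x x = 0) :
    ∫ x, (ψ (‖x‖ ^ 2) : ℂ) * (G x * Δ F x - F x * Δ G x) = 0 := by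
  classical
  set η : EuclideanSpace ℝ ι → ℂ := fun x => (ψ (‖x‖ ^ 2) : ℂ)
  have hne : ∀ x ∈ tsupport η, x ≠ 0 := fun x =>
    ne_zero_of_mem_tsupport_comp_sq_norm fun h => h0 (tsupport_comp_subset Complex.ofReal_zero ψ h)
  rw [← integral_divergence_eq_zero (V := fun i x => η x * greenField F G i x)]
  · refine integral_congr_ae (.of_forall fun x => ?_)
    by_cases hx : x ∈ tsupport η
    · exact (divergence_cutoff_greenField (hψ.differentiable one_ne_zero _) (hF x (hne x hx))
        (hG x (hne x hx)) (hF₀ x (hne x hx)) (hG₀ x (hne x hx))).symm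
    · have hzero : ∀ i, partialDeriv i (fun y => η y * greenField F G i y) x = 0 := fun i => by
        rw [partialDeriv, fderiv_of_notMem_tsupport ℝ fun h => hx (tsupport_mul_subset_left h),
          zero_apply]
      have hηx : (ψ (‖x‖ ^ 2) : ℂ) = 0 :=
        image_eq_zero_of_notMem_tsupport (f := η) hx
      simp only [hηx, zero_mul, divergence, hzero, Finset.sum_const_zero]
  · refine fun i => contMDiff_iff_contDiff.1 (contMDiff_of_tsupport fun x hx => ?_)
    have hx0 := hne x (tsupport_mul_subset_left hx)
    exact ((Complex.ofRealCLM.contDiff.comp (hψ.comp (contDiff_norm_sq ℝ))).contDiffAt.mul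
      (contDiffAt_greenField (hF x hx0) (hG x hx0) (by norm_num) i)).contMDiffAt
  · exact fun i =>
      (hasCompactSupport_comp_sq_norm (hc.comp_left Complex.ofReal_zero)).mul_right

end PartialDeriv

section PartialDeriv
open scoped Laplacian
variable {ι : Type*} [Fintype ι] {F G : EuclideanSpace ℝ ι → ℂ} {x : EuclideanSpace ℝ ι}

theorem contDiff_ofReal_coord {n : ℕ∞ω} (j : ι) :
    ContDiff ℝ n fun y : EuclideanSpace ℝ ι => (y j : ℂ) :=
  (Complex.ofRealCLM ∘L (EuclideanSpace.proj j : EuclideanSpace ℝ ι →L[ℝ] ℝ)).contDiff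

/-- The function `x ↦ ‖x‖ ^ (2 * s)`, complex-valued; meaningful away from the origin. -/
noncomputable def normPow (s : ℝ) (x : EuclideanSpace ℝ ι) : ℂ := (((‖x‖ ^ 2) ^ s : ℝ) : ℂ)

theorem normPow_of_norm_eq_one (s : ℝ) (hx : ‖x‖ = 1) : normPow s x = 1 := by
  simp [normPow, hx]

theorem sq_norm_mul_normPow_sub_one (s : ℝ) (hx : x ≠ 0) :
    ((‖x‖ ^ 2 : ℝ) : ℂ) * normPow (s - 1) x = normPow s x := by
  have h := Real.rpow_sub_one (pow_ne_zero 2 (norm_ne_zero_iff.2 hx)) s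
  rw [normPow, normPow, h, ← Complex.ofReal_mul, mul_div_cancel₀ _ (by simpa using hx)]

theorem contDiffAt_normPow {n : ℕ∞ω} (s : ℝ) (hx : x ≠ 0) : ContDiffAt ℝ n (normPow s) x :=
  Complex.ofRealCLM.contDiff.contDiffAt.comp x
    ((contDiff_norm_sq ℝ).contDiffAt.rpow_const_of_ne (by simpa using hx))

variable [DecidableEq ι]

theorem laplacian_fun_mul (hF : ContDiffAt ℝ 2 F x) (hG : ContDiffAt ℝ 2 G x) :
    Δ (fun y => F y * G y) x =
      F x * Δ G x + 2 * ∑ i, partialDeriv i F x * partialDeriv i G x + Δ F x * G x := by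
  have hd {H : EuclideanSpace ℝ ι → ℂ} {y} (h : ContDiffAt ℝ 2 H y) : DifferentiableAt ℝ H y :=
    h.differentiableAt two_ne_zero
  have hd' {H : EuclideanSpace ℝ ι → ℂ} (h : ContDiffAt ℝ 2 H x) (i : ι) :
      DifferentiableAt ℝ (partialDeriv i H) x :=
    (contDiffAt_partialDeriv (m := 1) h (by norm_num) i).differentiableAt one_ne_zero
  have hmul (i : ι) : partialDeriv i (fun y => F y * G y) =ᶠ[nhds x]
      fun y => F y * partialDeriv i G y + partialDeriv i F y * G y := by
    filter_upwards [hF.eventually (by simp), hG.eventually (by simp)] with y hFy hGy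
    exact partialDeriv_fun_mul (hd hFy) (hd hGy) i
  have hmul₂ (i : ι) : partialDeriv i (partialDeriv i fun y => F y * G y) x =
      F x * partialDeriv i (partialDeriv i G) x + 2 * (partialDeriv i F x * partialDeriv i G x) +
        partialDeriv i (partialDeriv i F) x * G x := by
    rw [partialDeriv_congr (hmul i), partialDeriv_fun_add ((hd hF).fun_mul (hd' hG i))
      ((hd' hF i).fun_mul (hd hG)), partialDeriv_fun_mul (hd hF) (hd' hG i),
      partialDeriv_fun_mul (hd' hF i) (hd hG)]
    ring
  simp only [laplacian_eq_sum_partialDeriv (hF.mul hG), laplacian_eq_sum_partialDeriv hF,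
    laplacian_eq_sum_partialDeriv hG, hmul₂, Finset.sum_add_distrib, Finset.mul_sum,
    Finset.sum_mul]

theorem partialDeriv_ofReal_coord (i j : ι) (x : EuclideanSpace ℝ ι) :
    partialDeriv i (fun y => (y j : ℂ)) x = if i = j then 1 else 0 := by
  have h : HasFDerivAt (fun y : EuclideanSpace ℝ ι => (y j : ℂ))
      (Complex.ofRealCLM ∘L (EuclideanSpace.proj j : EuclideanSpace ℝ ι →L[ℝ] ℝ)) x :=
    (Complex.ofRealCLM ∘L (EuclideanSpace.proj j : EuclideanSpace ℝ ι →L[ℝ] ℝ)).hasFDerivAt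
  rw [partialDeriv, h.fderiv]
  rcases eq_or_ne i j with rfl | hij
  · simp
  · simp [hij, hij.symm]

theorem partialDeriv_normPow (s : ℝ) (hx : x ≠ 0) (i : ι) :
    partialDeriv i (normPow s) x = 2 * s * (x i * normPow (s - 1) x) := by
  have hd := Real.hasDerivAt_rpow_const (p := s) (Or.inl (pow_ne_zero 2 (norm_ne_zero_iff.2 hx)))
  refine (partialDeriv_ofReal_comp_sq_norm hd.differentiableAt i).trans ?_
  rw [hd.deriv, normPow]
  push_cast
  ring

theorem partialDeriv_partialDeriv_normPow (s : ℝ) (hx : x ≠ 0) (i : ι) :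
    partialDeriv i (partialDeriv i (normPow s)) x =
      2 * s * normPow (s - 1) x + 4 * s * (s - 1) * normPow (s - 2) x * (x i) ^ 2 := by
  have hnear : partialDeriv i (normPow s) =ᶠ[nhds x]
      fun y => (2 * s : ℂ) * (y i * normPow (s - 1) y) := by
    filter_upwards [isOpen_compl_singleton.mem_nhds hx] with y hy
    exact partialDeriv_normPow s hy i
  have hcoord := (contDiff_ofReal_coord (n := 1) i).differentiable one_ne_zero x
  have hpow := (contDiffAt_normPow (n := 1) (s - 1) hx).differentiableAt one_ne_zero
  have hconst : partialDeriv i (fun _ => (2 * s : ℂ)) x = 0 := by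
    simp only [partialDeriv, fderiv_const_apply, zero_apply]
  rw [partialDeriv_congr hnear,
    partialDeriv_fun_mul (differentiableAt_const _) (hcoord.fun_mul hpow),
    partialDeriv_fun_mul hcoord hpow, hconst, partialDeriv_normPow _ hx,
    partialDeriv_ofReal_coord, if_pos rfl, show s - 1 - 1 = s - 2 by ring]
  push_cast
  ring

omit [DecidableEq ι] in
theorem laplacian_normPow (s : ℝ) (hx : x ≠ 0) :
    (Δ (normPow s : EuclideanSpace ℝ ι → ℂ)) x =
      2 * s * (2 * s - 2 + Fintype.card ι) * normPow (s - 1) x := by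
  classical
  have hsq : ∑ i, (x i : ℂ) ^ 2 = (‖x‖ ^ 2 : ℝ) := by
    rw [EuclideanSpace.norm_sq_eq]
    simp
  rw [laplacian_eq_sum_partialDeriv (contDiffAt_normPow s hx)]
  simp only [partialDeriv_partialDeriv_normPow s hx, Finset.sum_add_distrib, ← Finset.mul_sum,
    hsq, Finset.sum_const, Finset.card_univ, nsmul_eq_mul]
  rw [← sq_norm_mul_normPow_sub_one (s - 1) hx, show s - 1 - 1 = s - 2 by ring]
  ring

end PartialDeriv

section PolynomialFunctions

open MvPolynomial
open scoped Laplacian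

variable {ι : Type*}

/-- The function on Euclidean space defined by a polynomial with complex coefficients. -/
noncomputable def polyFun (p : MvPolynomial ι ℂ) (x : EuclideanSpace ℝ ι) : ℂ :=
  eval (fun i => (x i : ℂ)) p

variable {p : MvPolynomial ι ℂ} {k : ℕ}

theorem polyFun_smul (hp : p.IsHomogeneous k) (c : ℝ) (x : EuclideanSpace ℝ ι) :
    polyFun p (c • x) = (c : ℂ) ^ k * polyFun p x := by
  simp only [polyFun, eval_eq, Finset.mul_sum]
  refine Finset.sum_congr rfl fun d hd => ?_
  simp only [PiLp.smul_apply, smul_eq_mul, Complex.ofReal_mul, mul_pow, Finset.prod_mul_distrib,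
    Finset.prod_pow_eq_pow_sum, ← hp.degree_eq_sum_deg_support hd]
  ring

variable [Fintype ι]

theorem contDiff_polyFun {n : ℕ∞ω} (p : MvPolynomial ι ℂ) : ContDiff ℝ n (polyFun p) := by
  have h : polyFun p = fun x => ∑ d ∈ p.support, coeff d p * ∏ i, (x i : ℂ) ^ d i :=
    funext fun x => eval_eq' _ p
  rw [h]
  exact ContDiff.sum fun d _ => contDiff_const.mul <|
    contDiff_prod fun i _ => (contDiff_ofReal_coord i).pow _

theorem differentiable_polyFun (p : MvPolynomial ι ℂ) : Differentiable ℝ (polyFun p) :=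
  (contDiff_polyFun (n := 1) p).differentiable one_ne_zero

variable [DecidableEq ι]

theorem partialDeriv_polyFun (i : ι) (p : MvPolynomial ι ℂ) :
    partialDeriv i (polyFun p) = polyFun (pderiv i p) := by
  funext x
  induction p using MvPolynomial.induction_on with
  | C c =>
    have hC : polyFun (C c : MvPolynomial ι ℂ) = fun _ => c := by funext x; simp [polyFun]
    simp [hC, polyFun, partialDeriv]
  | add p q hp hq =>
    have hadd (p q : MvPolynomial ι ℂ) : polyFun (p + q) = fun x => polyFun p x + polyFun q x := by
      funext x; simp [polyFun]
    rw [hadd, partialDeriv_fun_add (differentiable_polyFun p x) (differentiable_polyFun q x), hp,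
      hq, map_add, hadd]
  | mul_X p j hp =>
    have hmul : polyFun (p * X j) = fun x => polyFun p x * (x j : ℂ) := by
      funext x; simp [polyFun]
    rw [hmul, partialDeriv_fun_mul (differentiable_polyFun p x)
      ((contDiff_ofReal_coord (n := 1) j).differentiable one_ne_zero x), hp,
      partialDeriv_ofReal_coord]
    rcases eq_or_ne i j with rfl | hij
    · simp [polyFun, Derivation.leibniz, mul_comm]
    · simp [polyFun, Derivation.leibniz, hij, pderiv_X_of_ne hij.symm, mul_comm]

theorem sum_coord_mul_partialDeriv_polyFun (hp : p.IsHomogeneous k) (x : EuclideanSpace ℝ ι) :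
    ∑ i, (x i : ℂ) * partialDeriv i (polyFun p) x = k * polyFun p x := by
  have h := congrArg (fun q => polyFun q x) hp.sum_X_mul_pderiv
  simpa [partialDeriv_polyFun, polyFun] using h

/-- The Laplacian of a polynomial, as a polynomial. -/
noncomputable def polyLaplacian (p : MvPolynomial ι ℂ) : MvPolynomial ι ℂ :=
  ∑ i, pderiv i (pderiv i p)

omit [DecidableEq ι] in
theorem laplacian_polyFun (p : MvPolynomial ι ℂ) : Δ (polyFun p) = polyFun (polyLaplacian p) := by
  classical
  funext x
  simp only [laplacian_eq_sum_partialDeriv (contDiff_polyFun p).contDiffAt, partialDeriv_polyFun]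
  simp only [polyFun, polyLaplacian, map_sum]

omit [DecidableEq ι] in
theorem laplacian_normPow_mul_polyFun (hp : p.IsHomogeneous k) {x : EuclideanSpace ℝ ι}
    (hx : ‖x‖ = 1) :
    Δ (fun y => normPow (-(k / 2)) y * polyFun p y) x =
      polyFun (polyLaplacian p) x - k * (k + Fintype.card ι - 2) * polyFun p x := by
  classical
  have hx0 : x ≠ 0 := norm_ne_zero_iff.1 (hx ▸ one_ne_zero)
  have hcross : ∑ i, partialDeriv i (normPow (-(k / 2))) x * partialDeriv i (polyFun p) x =
      -(k * (k * polyFun p x)) := by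
    rw [← sum_coord_mul_partialDeriv_polyFun hp, Finset.mul_sum, ← Finset.sum_neg_distrib]
    refine Finset.sum_congr rfl fun i _ => ?_
    rw [partialDeriv_normPow _ hx0, normPow_of_norm_eq_one _ hx]
    push_cast
    ring
  rw [laplacian_fun_mul (contDiffAt_normPow _ hx0) (contDiff_polyFun p).contDiffAt, hcross,
    laplacian_polyFun, laplacian_normPow _ hx0]
  simp only [normPow_of_norm_eq_one _ hx]
  push_cast
  ring

end PolynomialFunctions

section SphereCalculus

open scoped Laplacian

/-- Euclidean three-space. -/
abbrev E3 : Type := EuclideanSpace ℝ (Fin 3)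

variable {f g : S2 → ℂ} {x : E3} {r : ℝ}

theorem S2.norm_eq_one (x : S2) : ‖(x : E3)‖ = 1 := norm_eq_of_mem_sphere x

theorem S2.ne_zero (x : S2) : (x : E3) ≠ 0 := ne_zero_of_mem_unit_sphere x

theorem S2.exists_pos_smul_eq (hx : x ≠ 0) : ∃ r : ℝ, 0 < r ∧ ∃ y : S2, x = r • (y : E3) :=
  ⟨‖x‖, norm_pos_iff.2 hx, ⟨‖x‖⁻¹ • x, mem_sphere_zero_iff_norm.2 (norm_smul_inv_norm (𝕜 := ℝ) hx)⟩,
    (smul_inv_smul₀ (norm_ne_zero_iff.2 hx) x).symm⟩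

theorem radialExtension_smul_coe (f : S2 → ℂ) (hr : 0 < r) (x : S2) :
    radialExtension f (r • (x : E3)) = f x := by
  rw [radialExtension, dif_neg (smul_ne_zero hr.ne' x.ne_zero)]
  congr 1
  ext1
  simp [norm_smul, abs_of_pos hr, smul_smul, hr.ne']

theorem radialExtension_smul_pos (f : S2 → ℂ) (hr : 0 < r) (x : E3) :
    radialExtension f (r • x) = radialExtension f x := by
  rcases eq_or_ne x 0 with rfl | hx
  · rw [smul_zero]
  · obtain ⟨s, hs, y, rfl⟩ := S2.exists_pos_smul_eq hx
    rw [smul_smul, radialExtension_smul_coe f (mul_pos hr hs), radialExtension_smul_coe f hs]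

theorem IsSmoothS2.contDiffAt_of_ne_zero (hf : IsSmoothS2 f) (hx : x ≠ 0) :
    ContDiffAt ℝ 2 (radialExtension f) x :=
  (ContDiffOn.contDiffAt hf (isOpen_compl_singleton.mem_nhds hx)).of_le
    (WithTop.coe_le_coe.2 le_top)

theorem IsSmoothS2.fderiv_radialExtension_self (hf : IsSmoothS2 f) (hx : x ≠ 0) :
    fderiv ℝ (radialExtension f) x x = 0 :=
  fderiv_self_eq_zero_of_forall_pos_smul
    ((hf.contDiffAt_of_ne_zero hx).differentiableAt two_ne_zero)
    fun _ hr => radialExtension_smul_pos f hr x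

theorem laplacian_radialExtension_smul_coe (f : S2 → ℂ) (hr : 0 < r) (x : S2) :
    Δ (radialExtension f) (r • (x : E3)) = ((r : ℂ) ^ 2)⁻¹ * laplaceS2 f x := by
  have h := laplacian_comp_smul (radialExtension f) r x
  simp only [radialExtension_smul_pos f hr] at h
  rw [laplaceS2, h, Complex.real_smul, Complex.ofReal_pow, inv_mul_cancel_left₀]
  exact pow_ne_zero 2 (Complex.ofReal_ne_zero.2 hr.ne')

theorem integral_mul_laplaceS2_sub_eq_zero (hf : IsSmoothS2 f) (hg : IsSmoothS2 g) :
    ∫ x, (g x * laplaceS2 f x - f x * laplaceS2 g x) ∂volS2 = 0 := by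
  let ψ : ContDiffBump (1 : ℝ) := ⟨1 / 4, 1 / 2, by norm_num, by norm_num⟩
  have hψ₀ : (0 : ℝ) ∉ tsupport ψ := by
    rw [ψ.tsupport_eq, Metric.mem_closedBall]
    norm_num [ψ]
  have hψ₁ : ψ 1 ≠ 0 := by
    rw [ψ.one_of_mem_closedBall (Metric.mem_closedBall_self ψ.rIn_pos.le)]
    exact one_ne_zero
  have hpolar := integral_eq_radial_mul_integral_toSphere (volume : Measure E3)
    (F := fun x => (ψ (‖x‖ ^ 2) : ℂ) * (radialExtension g x * Δ (radialExtension f) x -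
      radialExtension f x * Δ (radialExtension g) x))
    (h := fun r => (ψ (r ^ 2) : ℂ) * ((r : ℂ) ^ 2)⁻¹)
    (f := fun x => g x * laplaceS2 f x - f x * laplaceS2 g x) fun r hr x => by
      simp only [norm_smul, S2.norm_eq_one, mul_one, Real.norm_of_nonneg hr.le,
        radialExtension_smul_coe _ hr, laplacian_radialExtension_smul_coe _ hr]
      ring
  have hradial : ∫ r in Set.Ioi (0 : ℝ),
      (r ^ (Module.finrank ℝ E3 - 1)) • ((ψ (r ^ 2) : ℂ) * ((r : ℂ) ^ 2)⁻¹) =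
      ((∫ r in Set.Ioi (0 : ℝ), ψ (r ^ 2) : ℝ) : ℂ) := by
    rw [← integral_complex_ofReal]
    refine setIntegral_congr_fun measurableSet_Ioi fun r (hr : 0 < r) => ?_
    have hr' : (r : ℂ) ≠ 0 := Complex.ofReal_ne_zero.2 hr.ne'
    simp only [finrank_euclideanSpace_fin, Nat.add_one_sub_one, Complex.real_smul]
    push_cast
    field_simp
  rw [integral_cutoff_mul_laplacian_sub_eq_zero ψ.contDiff ψ.hasCompactSupport hψ₀
    (fun _ => hf.contDiffAt_of_ne_zero) (fun _ => hg.contDiffAt_of_ne_zero)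
    (fun _ => hf.fderiv_radialExtension_self) (fun _ => hg.fderiv_radialExtension_self),
    hradial] at hpolar
  have hpos := integral_Ioi_comp_sq_pos ψ.continuous ψ.hasCompactSupport (fun _ => ψ.nonneg) hψ₁
  exact (mul_eq_zero.1 hpolar.symm).resolve_left (Complex.ofReal_ne_zero.2 hpos.ne')

theorem radialExtension_comp_sphereMap (f : S2 → ℂ) (R : E3 ≃ₗᵢ[ℝ] E3) :
    radialExtension (f ∘ sphereMap R) = radialExtension f ∘ R := by
  funext x
  rcases eq_or_ne x 0 with rfl | hx
  · simp [radialExtension]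
  · obtain ⟨r, hr, y, rfl⟩ := S2.exists_pos_smul_eq hx
    rw [radialExtension_smul_coe _ hr, Function.comp_apply, Function.comp_apply, map_smul,
      ← coe_sphereMap, radialExtension_smul_coe _ hr]

theorem comp_sphereMap_mem_sphericalHarmonics {l : ℕ} {f : C(S2, ℂ)}
    (hf : f ∈ sphericalHarmonics l) (R : E3 ≃ₗᵢ[ℝ] E3) :
    f.comp (sphereMap R) ∈ sphericalHarmonics l := by
  refine ⟨?_, fun x => ?_⟩
  · rw [IsSmoothS2, ContinuousMap.coe_comp, radialExtension_comp_sphereMap]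
    exact ContDiffOn.comp hf.1 R.contDiff.contDiffOn fun x hx => by simpa using hx
  · rw [laplaceS2, ContinuousMap.coe_comp, radialExtension_comp_sphereMap,
      laplacian_comp_linearIsometryEquiv]
    exact hf.2 (sphereMap R x)

theorem exists_sphereMap_eq (x y : S2) : ∃ R : E3 ≃ₗᵢ[ℝ] E3, sphereMap R x = y :=
  ⟨(ℝ ∙ ((x : E3) - y))ᗮ.reflection, Subtype.ext <|
    Submodule.reflection_sub (by rw [S2.norm_eq_one, S2.norm_eq_one])⟩

theorem radialExtension_conj (f : S2 → ℂ) :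
    radialExtension (fun x => starRingEnd ℂ (f x)) = Complex.conjCLE ∘ radialExtension f := by
  funext x
  by_cases hx : x = 0 <;> simp [radialExtension, hx]

theorem IsSmoothS2.conj (hf : IsSmoothS2 f) : IsSmoothS2 fun x => starRingEnd ℂ (f x) := by
  rw [IsSmoothS2, radialExtension_conj]
  exact Complex.conjCLE.contDiff.comp_contDiffOn hf

theorem laplaceS2_conj (hf : IsSmoothS2 f) (x : S2) :
    laplaceS2 (fun x => starRingEnd ℂ (f x)) x = starRingEnd ℂ (laplaceS2 f x) := by
  rw [laplaceS2, radialExtension_conj]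
  exact (hf.contDiffAt x).laplacian_CLM_comp_left (l := (Complex.conjCLE : ℂ →L[ℝ] ℂ))

end SphereCalculus

section PolynomialsOnSphere

open MvPolynomial
open scoped Laplacian

variable {p : MvPolynomial (Fin 3) ℂ} {k : ℕ}

/-- The restriction of polynomials to the sphere. -/
noncomputable def polyS2 : MvPolynomial (Fin 3) ℂ →ₐ[ℂ] C(S2, ℂ) :=
  aeval fun i => ⟨fun x => ((x : E3) i : ℂ), by fun_prop⟩

theorem polyS2_apply (p : MvPolynomial (Fin 3) ℂ) (x : S2) : polyS2 p x = polyFun p x := by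
  induction p using MvPolynomial.induction_on with
  | C c => simp [polyS2, polyFun]
  | add p q hp hq => simp [hp, hq, polyFun]
  | mul_X p j hp =>
    rw [map_mul, ContinuousMap.mul_apply, hp]
    simp [polyS2, polyFun]

theorem radialExtension_polyS2 (hp : p.IsHomogeneous k) {x : E3} (hx : x ≠ 0) :
    radialExtension (polyS2 p) x = normPow (-(k / 2)) x * polyFun p x := by
  obtain ⟨r, hr, y, rfl⟩ := S2.exists_pos_smul_eq hx
  have hpow : normPow (-(k / 2)) (r • (y : E3)) = ((r : ℂ) ^ k)⁻¹ := by
    rw [normPow, norm_smul, S2.norm_eq_one, mul_one, Real.norm_of_nonneg hr.le,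
      ← Real.rpow_natCast_mul hr.le, ← Complex.ofReal_pow, ← Complex.ofReal_inv,
      ← Real.rpow_natCast r k, ← Real.rpow_neg hr.le]
    congr 2
    push_cast
    ring
  rw [radialExtension_smul_coe _ hr, polyS2_apply, polyFun_smul hp, hpow, inv_mul_cancel_left₀]
  exact pow_ne_zero k (Complex.ofReal_ne_zero.2 hr.ne')

theorem radialExtension_polyS2_eventuallyEq (hp : p.IsHomogeneous k) {x : E3} (hx : x ≠ 0) :
    radialExtension (polyS2 p) =ᶠ[nhds x] fun y => normPow (-(k / 2)) y * polyFun p y := by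
  filter_upwards [isOpen_compl_singleton.mem_nhds hx] with y hy using radialExtension_polyS2 hp hy

theorem isSmoothS2_polyS2 (hp : p.IsHomogeneous k) : IsSmoothS2 (polyS2 p) := fun _ hx =>
  (((contDiffAt_normPow _ hx).mul (contDiff_polyFun p).contDiffAt).congr_of_eventuallyEq
    (radialExtension_polyS2_eventuallyEq hp hx)).contDiffWithinAt

theorem laplaceS2_polyS2 (hp : p.IsHomogeneous k) (x : S2) :
    laplaceS2 (polyS2 p) x = polyS2 (polyLaplacian p) x - k * (k + 1) * polyS2 p x := by
  have hcongr := InnerProductSpace.laplacian_congr_nhds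
    (radialExtension_polyS2_eventuallyEq hp x.ne_zero)
  rw [laplaceS2, hcongr.eq_of_nhds, laplacian_normPow_mul_polyFun hp x.norm_eq_one, polyS2_apply,
    polyS2_apply, Fintype.card_fin]
  push_cast
  ring

end PolynomialsOnSphere

section HomogeneousPolynomials

open MvPolynomial

theorem finrank_homogeneousSubmodule (σ K : Type*) [Fintype σ] [Field K] (k : ℕ) :
    Module.finrank K (homogeneousSubmodule σ K k) = (Fintype.card σ + k - 1).choose k := by
  classical
  have hset : {d : σ →₀ ℕ | d.degree = k} =
      ((Finset.univ : Finset σ).finsuppAntidiag k : Set (σ →₀ ℕ)) := by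
    ext d
    simp [Finsupp.degree_eq_sum]
  rw [homogeneousSubmodule_eq_finsupp_supported,
    (AddMonoidAlgebra.supportedEquivFinsupp {d : σ →₀ ℕ | d.degree = k}).finrank_eq, hset,
    Module.finrank_finsupp_self, ← Nat.card_eq_fintype_card, Nat.card_coe_set_eq,
    Set.ncard_coe_finset, Finset.card_finsuppAntidiag_nat_eq_choose, Finset.card_univ]

theorem pderiv_eq_zero_of_isHomogeneous_zero {σ R : Type*} [CommSemiring R]
    {p : MvPolynomial σ R} (hp : p.IsHomogeneous 0) (i : σ) : pderiv i p = 0 := by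
  rw [← totalDegree_zero_iff_isHomogeneous, totalDegree_eq_zero_iff_eq_C] at hp
  rw [hp, pderiv_C]

theorem polyFun_injective {ι : Type*} :
    Function.Injective (polyFun : MvPolynomial ι ℂ → EuclideanSpace ℝ ι → ℂ) := fun p q h => by
  refine funext_set (fun _ => Set.range Complex.ofReal)
    (fun _ => Set.infinite_range_of_injective Complex.ofReal_injective) fun x hx => ?_
  choose y hy using fun i => hx i (Set.mem_univ i)
  obtain rfl : (fun i => (y i : ℂ)) = x := funext hy
  exact congrFun h (WithLp.toLp 2 y)

end HomogeneousPolynomials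

section HomPolyS2

open MvPolynomial

variable {p : MvPolynomial (Fin 3) ℂ} {f : C(S2, ℂ)} {k : ℕ}

/-- The restrictions to the sphere of the homogeneous polynomials of degree `k`. -/
noncomputable def homPolyS2 (k : ℕ) : Submodule ℂ C(S2, ℂ) :=
  (homogeneousSubmodule (Fin 3) ℂ k).map polyS2.toLinearMap

/-- The space `homPolyS2 (k - 2)`, understood to be trivial when `k < 2`. -/
noncomputable def homPolyS2SubTwo : ℕ → Submodule ℂ C(S2, ℂ)
  | 0 | 1 => ⊥
  | k + 2 => homPolyS2 k

theorem polyS2_mem_homPolyS2 (hp : p.IsHomogeneous k) : polyS2 p ∈ homPolyS2 k :=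
  ⟨p, (mem_homogeneousSubmodule _ _).2 hp, rfl⟩

theorem exists_isHomogeneous_of_mem_homPolyS2 (hf : f ∈ homPolyS2 k) :
    ∃ p, p.IsHomogeneous k ∧ polyS2 p = f := by
  obtain ⟨p, hp, rfl⟩ := hf
  exact ⟨p, (mem_homogeneousSubmodule _ _).1 hp, rfl⟩

theorem isSmoothS2_of_mem_homPolyS2 (hf : f ∈ homPolyS2 k) : IsSmoothS2 f := by
  obtain ⟨p, hp, rfl⟩ := exists_isHomogeneous_of_mem_homPolyS2 hf
  exact isSmoothS2_polyS2 hp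

theorem polyS2_sum_X_sq : polyS2 (∑ i, X i ^ 2) = 1 := by
  ext x
  have h := EuclideanSpace.real_norm_sq_eq (x : E3)
  rw [S2.norm_eq_one, one_pow] at h
  rw [polyS2_apply]
  simp only [polyFun, map_sum, map_pow, eval_X, ContinuousMap.one_apply]
  exact_mod_cast h.symm

theorem homPolyS2SubTwo_le (k : ℕ) : homPolyS2SubTwo k ≤ homPolyS2 k := by
  match k with
  | 0 | 1 => exact bot_le
  | k + 2 =>
    intro f hf
    obtain ⟨p, hp, rfl⟩ := exists_isHomogeneous_of_mem_homPolyS2 hf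
    have hsq : (∑ i : Fin 3, (X i : MvPolynomial (Fin 3) ℂ) ^ 2).IsHomogeneous 2 :=
      .sum _ _ _ fun i _ => by simpa using (isHomogeneous_X ℂ i).pow 2
    have h := polyS2_mem_homPolyS2 (hp.mul hsq)
    rwa [map_mul, polyS2_sum_X_sq, mul_one] at h

theorem polyS2_polyLaplacian_mem (hp : p.IsHomogeneous k) :
    polyS2 (polyLaplacian p) ∈ homPolyS2SubTwo k := by
  match k with
  | 0 => simp [polyLaplacian, pderiv_eq_zero_of_isHomogeneous_zero hp]
  | 1 => simp [polyLaplacian, pderiv_eq_zero_of_isHomogeneous_zero hp.pderiv]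
  | k + 2 => exact polyS2_mem_homPolyS2 (.sum _ _ _ fun i _ => hp.pderiv.pderiv)

theorem exists_laplaceS2_add_eq (hf : f ∈ homPolyS2 k) :
    ∃ h ∈ homPolyS2SubTwo k, ∀ x, laplaceS2 f x + k * (k + 1) * f x = h x := by
  obtain ⟨p, hp, rfl⟩ := exists_isHomogeneous_of_mem_homPolyS2 hf
  refine ⟨_, polyS2_polyLaplacian_mem hp, fun x => ?_⟩
  rw [laplaceS2_polyS2 hp, sub_add_cancel]

theorem exists_laplaceS2_eq (hf : f ∈ homPolyS2SubTwo k) :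
    ∃ h ∈ homPolyS2SubTwo k, ∀ x, laplaceS2 f x = h x := by
  match k with
  | 0 | 1 =>
    obtain rfl : f = 0 := hf
    exact ⟨0, Submodule.zero_mem _, fun x => by simpa using (sphericalHarmonics 0).zero_mem.2 x⟩
  | k + 2 =>
    obtain ⟨h, hh, hx⟩ := exists_laplaceS2_add_eq (k := k) hf
    refine ⟨h - ((k : ℂ) * (k + 1)) • f, Submodule.sub_mem _ (homPolyS2SubTwo_le k hh)
      (Submodule.smul_mem _ _ hf), fun x => ?_⟩
    rw [ContinuousMap.sub_apply, ContinuousMap.smul_apply, smul_eq_mul, ← hx x,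
      add_sub_cancel_right]

theorem eq_zero_of_polyS2_eq_zero (hp : p.IsHomogeneous k) (h : polyS2 p = 0) : p = 0 := by
  have hsphere (r : ℝ) (y : S2) : polyFun p (r • (y : E3)) = 0 := by
    rw [polyFun_smul hp, ← polyS2_apply, h, ContinuousMap.zero_apply, mul_zero]
  refine polyFun_injective (funext fun x => ?_)
  rw [show polyFun (0 : MvPolynomial (Fin 3) ℂ) x = 0 from map_zero _]
  rcases eq_or_ne x 0 with rfl | hx
  · obtain ⟨y, hy⟩ := NormedSpace.sphere_nonempty (x := (0 : E3)).2 zero_le_one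
    simpa using hsphere 0 ⟨y, hy⟩
  · obtain ⟨r, -, y, rfl⟩ := S2.exists_pos_smul_eq hx
    exact hsphere r y

instance (k : ℕ) : FiniteDimensional ℂ (homPolyS2 k) :=
  have : FiniteDimensional ℂ (homogeneousSubmodule (Fin 3) ℂ k) :=
    Module.Finite.iff_fg.2 (homogeneousSubmodule_fg _ _ k)
  Module.Finite.map _ _

theorem finrank_homPolyS2 (k : ℕ) : Module.finrank ℂ (homPolyS2 k) = (k + 2).choose 2 := by
  have hinj : Function.Injective
      (polyS2.toLinearMap.domRestrict (homogeneousSubmodule (Fin 3) ℂ k)) := by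
    rw [← LinearMap.ker_eq_bot, LinearMap.ker_eq_bot']
    exact fun p h =>
      Subtype.ext (eq_zero_of_polyS2_eq_zero ((mem_homogeneousSubmodule _ _).1 p.2) h)
  rw [homPolyS2, ← LinearMap.range_domRestrict, LinearMap.finrank_range_of_inj hinj,
    finrank_homogeneousSubmodule, Fintype.card_fin, show 3 + k - 1 = k + 2 by omega,
    Nat.choose_symm_add]

theorem finrank_homPolyS2SubTwo_add (k : ℕ) :
    Module.finrank ℂ (homPolyS2SubTwo k) + (2 * k + 1) = Module.finrank ℂ (homPolyS2 k) := by
  match k with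
  | 0 | 1 =>
    rw [finrank_homPolyS2, homPolyS2SubTwo, finrank_bot]
    rfl
  | k + 2 =>
    rw [homPolyS2SubTwo, finrank_homPolyS2, finrank_homPolyS2, Nat.choose_succ_succ (k + 3) 1,
      Nat.choose_succ_succ (k + 2) 1, Nat.choose_one_right, Nat.choose_one_right]
    ring

theorem polyS2_mem_iSup_homPolyS2 (p : MvPolynomial (Fin 3) ℂ) :
    polyS2 p ∈ ⨆ k, homPolyS2 k := by
  rw [← sum_homogeneousComponent p, map_sum]
  exact Submodule.sum_mem _ fun k _ => Submodule.mem_iSup_of_mem k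
    (polyS2_mem_homPolyS2 (homogeneousComponent_isHomogeneous k p))

theorem denseRange_polyS2 : DenseRange polyS2 := by
  let A : StarSubalgebra ℂ C(S2, ℂ) :=
    { polyS2.range with
      star_mem' := by
        rintro _ ⟨p, rfl⟩
        refine ⟨map (starRingEnd ℂ) p, ContinuousMap.ext fun x => ?_⟩
        change polyS2 _ x = star (polyS2 p x)
        rw [polyS2_apply, polyS2_apply]
        simp only [polyFun, eval_map]
        rw [eval₂_eq', eval_eq']
        simp }
  have hsep : A.SeparatesPoints := fun x y hxy => by
    obtain ⟨i, hi⟩ : ∃ i, (x : E3) i ≠ (y : E3) i := by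
      by_contra! h
      exact hxy (Subtype.ext (PiLp.ext h))
    exact ⟨polyS2 (X i), ⟨_, ⟨X i, rfl⟩, rfl⟩, by simpa [polyS2_apply, polyFun] using hi⟩
  have htop := ContinuousMap.starSubalgebra_topologicalClosure_eq_top_of_separatesPoints A hsep
  exact dense_iff_closure_eq.2 (congrArg SetLike.coe htop)

end HomPolyS2

section HarmonicsInL2

variable {f g f' g' : C(S2, ℂ)} {k l : ℕ}

/-- The embedding of the continuous functions on the sphere into `L²(S²)`. -/
noncomputable def toL2 : C(S2, ℂ) →ₗ[ℂ] Lp ℂ 2 volS2 :=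
  (ContinuousMap.toLp 2 volS2 ℂ : C(S2, ℂ) →L[ℂ] Lp ℂ 2 volS2).toLinearMap

theorem continuous_toL2 : Continuous toL2 :=
  (ContinuousMap.toLp 2 volS2 ℂ : C(S2, ℂ) →L[ℂ] Lp ℂ 2 volS2).continuous

theorem toL2_injective : Function.Injective toL2 :=
  ContinuousMap.toLp_injective volS2

theorem inner_toL2 (f g : C(S2, ℂ)) :
    inner ℂ (toL2 f) (toL2 g) = ∫ x, starRingEnd ℂ (f x) * g x ∂volS2 := by
  refine (ContinuousMap.inner_toLp volS2 f g).trans ?_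
  simp_rw [mul_comm]

theorem inner_toL2_eq_inner_toL2_of_laplaceS2_eq (hf : IsSmoothS2 f) (hg : IsSmoothS2 g)
    (hf' : ∀ x, laplaceS2 f x = f' x) (hg' : ∀ x, laplaceS2 g x = g' x) :
    inner ℂ (toL2 f') (toL2 g) = inner ℂ (toL2 f) (toL2 g') := by
  have h := integral_mul_laplaceS2_sub_eq_zero hf.conj hg
  simp only [laplaceS2_conj hf, hf', hg', mul_comm (g _)] at h
  rw [inner_toL2, inner_toL2, ← sub_eq_zero, ← h,
    integral_sub (integrable_conj_mul _ _) (integrable_conj_mul _ _)]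

theorem laplaceS2_of_mem_sphericalHarmonics (hf : f ∈ sphericalHarmonics l) (x : S2) :
    laplaceS2 f x = (-((l : ℂ) * (l + 1)) • f) x := by
  rw [ContinuousMap.smul_apply, smul_eq_mul, neg_mul]
  exact eq_neg_of_add_eq_zero_left (hf.2 x)

theorem inner_toL2_eq_zero_of_ne (hkl : k ≠ l) (hf : f ∈ sphericalHarmonics k)
    (hg : g ∈ sphericalHarmonics l) : inner ℂ (toL2 f) (toL2 g) = 0 := by
  have hgreen := inner_toL2_eq_inner_toL2_of_laplaceS2_eq hf.1 hg.1
    (laplaceS2_of_mem_sphericalHarmonics hf) (laplaceS2_of_mem_sphericalHarmonics hg)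
  by_contra hne
  have heigen : k * (k + 1) = l * (l + 1) := by
    rw [map_smul, map_smul, inner_smul_left, inner_smul_right, mul_left_inj' hne] at hgreen
    simp only [map_neg, map_mul, map_add, map_natCast, map_one, neg_inj] at hgreen
    exact_mod_cast hgreen
  rcases hkl.lt_or_gt with h | h <;> nlinarith

/-- The orthogonal complement in `L²(S²)` of `homPolyS2SubTwo k` in `homPolyS2 k`. It is shown to
be the space of spherical harmonics of degree `k`. -/
noncomputable def harmonicL2 (k : ℕ) : Submodule ℂ (Lp ℂ 2 volS2) :=
  ((homPolyS2SubTwo k).map toL2)ᗮ ⊓ (homPolyS2 k).map toL2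

instance (k : ℕ) : FiniteDimensional ℂ ((homPolyS2 k).map toL2) := Module.Finite.map _ _

instance (k : ℕ) : FiniteDimensional ℂ ((homPolyS2SubTwo k).map toL2) :=
  Submodule.finiteDimensional_of_le (Submodule.map_mono (homPolyS2SubTwo_le k))

instance (k : ℕ) : FiniteDimensional ℂ (harmonicL2 k) :=
  Submodule.finiteDimensional_of_le inf_le_right

theorem finrank_map_toL2 (K : Submodule ℂ C(S2, ℂ)) :
    Module.finrank ℂ (K.map toL2) = Module.finrank ℂ K :=
  (Submodule.equivMapOfInjective toL2 toL2_injective K).finrank_eq.symm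

theorem finrank_harmonicL2 (k : ℕ) : Module.finrank ℂ (harmonicL2 k) = 2 * k + 1 := by
  refine Submodule.finrank_add_inf_finrank_orthogonal'
    (Submodule.map_mono (homPolyS2SubTwo_le k)) ?_
  rw [finrank_map_toL2, finrank_map_toL2, finrank_homPolyS2SubTwo_add]

theorem harmonicL2_le (k : ℕ) : harmonicL2 k ≤ (sphericalHarmonics k).map toL2 := by
  rintro u ⟨hu, f, hf, rfl⟩
  have hperp : ∀ v ∈ homPolyS2SubTwo k, inner ℂ (toL2 v) (toL2 f) = 0 := fun v hv =>
    (Submodule.mem_orthogonal _ _).1 hu _ (Submodule.mem_map_of_mem hv)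
  obtain ⟨h, hh, hfh⟩ := exists_laplaceS2_add_eq hf
  obtain ⟨h', hh', hhh'⟩ := exists_laplaceS2_eq hh
  have hfh' (x : S2) : laplaceS2 f x = (h - ((k : ℂ) * (k + 1)) • f) x := by
    rw [ContinuousMap.sub_apply, ContinuousMap.smul_apply, smul_eq_mul, ← hfh, add_sub_cancel_right]
  -- Green's formula turns `⟪h, (Δ + k (k + 1)) f⟫ = ‖h‖²` into `⟪Δ h, f⟫`, which vanishes.
  have hgreen := inner_toL2_eq_inner_toL2_of_laplaceS2_eq
    (isSmoothS2_of_mem_homPolyS2 (homPolyS2SubTwo_le k hh)) (isSmoothS2_of_mem_homPolyS2 hf)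
    hhh' hfh'
  rw [hperp h' hh', map_sub, map_smul, inner_sub_right, inner_smul_right, hperp h hh, mul_zero,
    sub_zero] at hgreen
  have hh0 : h = 0 :=
    toL2_injective ((inner_self_eq_zero.1 hgreen.symm).trans (map_zero toL2).symm)
  exact ⟨f, ⟨isSmoothS2_of_mem_homPolyS2 hf, fun x => by rw [hfh, hh0]; rfl⟩, rfl⟩

theorem map_homPolyS2_le_of_harmonicL2_le {K : Submodule ℂ (Lp ℂ 2 volS2)}
    (hK : ∀ k, harmonicL2 k ≤ K) (k : ℕ) : (homPolyS2 k).map toL2 ≤ K := by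
  induction k using Nat.strong_induction_on with
  | _ k ih =>
    rw [← Submodule.sup_orthogonal_inf_of_hasOrthogonalProjection
      (Submodule.map_mono (f := toL2) (homPolyS2SubTwo_le k))]
    refine sup_le ?_ (hK k)
    match k with
    | 0 | 1 =>
      rw [homPolyS2SubTwo, Submodule.map_bot]
      exact bot_le
    | k + 2 => exact ih k (by lia)

theorem eq_zero_of_forall_inner_harmonicL2_eq_zero
    (hf : ∀ k, ∀ u ∈ harmonicL2 k, inner ℂ u (toL2 f) = 0) : f = 0 := by
  have hhom : ⨆ k, homPolyS2 k ≤ ((ℂ ∙ toL2 f)ᗮ).comap toL2 :=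
    iSup_le fun k => Submodule.map_le_iff_le_comap.1 <| map_homPolyS2_le_of_harmonicL2_le
      (fun k u hu => Submodule.mem_orthogonal_singleton_iff_inner_left.2 (hf k u hu)) k
  have hpoly (p : MvPolynomial (Fin 3) ℂ) : inner ℂ (toL2 (polyS2 p)) (toL2 f) = 0 :=
    Submodule.mem_orthogonal_singleton_iff_inner_left.1 (hhom (polyS2_mem_iSup_homPolyS2 p))
  have hall : (fun g => inner ℂ (toL2 g) (toL2 f)) = fun _ : C(S2, ℂ) => (0 : ℂ) :=
    denseRange_polyS2.equalizer (continuous_toL2.inner continuous_const) continuous_const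
      (funext hpoly)
  exact toL2_injective ((inner_self_eq_zero.1 (congrFun hall f)).trans (map_zero toL2).symm)

theorem map_sphericalHarmonics (l : ℕ) : (sphericalHarmonics l).map toL2 = harmonicL2 l := by
  refine le_antisymm ?_ (harmonicL2_le l)
  rintro _ ⟨f, hf, rfl⟩
  have hproj : (harmonicL2 l).starProjection (toL2 f) ∈ harmonicL2 l :=
    Submodule.starProjection_apply_mem _ _
  obtain ⟨g, hg, hgf⟩ := harmonicL2_le l hproj
  suffices f - g = 0 by rwa [sub_eq_zero.1 this, hgf]
  refine eq_zero_of_forall_inner_harmonicL2_eq_zero fun k v hv => ?_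
  rcases eq_or_ne k l with rfl | hkl
  · rw [map_sub, hgf]
    exact (Submodule.mem_orthogonal _ _).1
      (Submodule.sub_starProjection_mem_orthogonal (K := harmonicL2 k) (toL2 f)) v hv
  · obtain ⟨w, hw, rfl⟩ := harmonicL2_le k hv
    exact inner_toL2_eq_zero_of_ne hkl hw (Submodule.sub_mem _ hf hg)

theorem finrank_sphericalHarmonics (l : ℕ) :
    Module.finrank ℂ (sphericalHarmonics l) = 2 * l + 1 := by
  rw [← finrank_map_toL2, map_sphericalHarmonics, finrank_harmonicL2]

instance (l : ℕ) : FiniteDimensional ℂ (sphericalHarmonics l) :=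
  FiniteDimensional.of_finrank_pos (by rw [finrank_sphericalHarmonics]; exact Nat.succ_pos _)

end HarmonicsInL2

section HarmonicONB

variable {l : ℕ} {e e' : Fin (2 * l + 1) → C(S2, ℂ)}

theorem orthonormal_toL2_comp_iff {ι : Type*} [DecidableEq ι] {e : ι → C(S2, ℂ)} :
    Orthonormal ℂ (toL2 ∘ e) ↔
      ∀ m n, ∫ x, starRingEnd ℂ (e m x) * e n x ∂volS2 = if m = n then 1 else 0 := by
  simp only [orthonormal_iff_ite, Function.comp_apply, inner_toL2]

theorem isHarmonicONB_iff_orthonormal :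
    IsHarmonicONB l e ↔ (∀ m, e m ∈ sphericalHarmonics l) ∧ Orthonormal ℂ (toL2 ∘ e) := by
  rw [orthonormal_toL2_comp_iff, IsHarmonicONB, and_congr_left_iff]
  intro he
  refine ⟨fun h m => h ▸ Submodule.subset_span (Set.mem_range_self m), fun h => ?_⟩
  have hli : LinearIndependent ℂ e :=
    (orthonormal_toL2_comp_iff.2 he).linearIndependent.of_comp
  refine Submodule.eq_of_le_of_finrank_eq (Submodule.span_le.2 (Set.range_subset_iff.2 h)) ?_
  rw [finrank_span_eq_card hli, finrank_sphericalHarmonics, Fintype.card_fin]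

instance (l : ℕ) : Nonempty (HarmonicONB l) := by
  let b := (stdOrthonormalBasis ℂ (harmonicL2 l)).reindex (finCongr (finrank_harmonicL2 l))
  choose e he heb using fun m => harmonicL2_le l (b m).2
  refine ⟨⟨e, isHarmonicONB_iff_orthonormal.2 ⟨he, ?_⟩⟩⟩
  rw [show toL2 ∘ e = (harmonicL2 l).subtypeₗᵢ ∘ b from funext heb]
  exact b.orthonormal.comp_linearIsometry _

theorem sum_norm_sq_apply_orthonormalBasis {𝕜 E ι : Type*} [RCLike 𝕜] [NormedAddCommGroup E]
    [InnerProductSpace 𝕜 E] [Fintype ι] (b b' : OrthonormalBasis ι 𝕜 E) (φ : E →ₗ[𝕜] 𝕜) :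
    ∑ i, ‖φ (b i)‖ ^ 2 = ∑ i, ‖φ (b' i)‖ ^ 2 := by
  have : FiniteDimensional 𝕜 E := b.toBasis.finiteDimensional_of_finite
  have : CompleteSpace E := FiniteDimensional.complete 𝕜 E
  let v : E := (InnerProductSpace.toDual 𝕜 E).symm φ.toContinuousLinearMap
  have hv (u : E) : φ u = inner 𝕜 v u := by
    rw [InnerProductSpace.toDual_symm_apply, LinearMap.coe_toContinuousLinearMap']
  simp only [hv, OrthonormalBasis.sum_sq_norm_inner_left]

/-- A harmonic orthonormal basis, as an orthonormal basis of a subspace of `L²(S²)`. -/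
noncomputable def IsHarmonicONB.orthonormalBasis (he : IsHarmonicONB l e) :
    OrthonormalBasis (Fin (2 * l + 1)) ℂ ((sphericalHarmonics l).map toL2) :=
  have h := isHarmonicONB_iff_orthonormal.1 he
  have ho := h.2.codRestrict _ fun m => Submodule.mem_map_of_mem (h.1 m)
  .mk ho (ho.linearIndependent.span_eq_top_of_card_eq_finrank (by
    rw [finrank_map_toL2, finrank_sphericalHarmonics, Fintype.card_fin])).ge

theorem IsHarmonicONB.sum_norm_sq_apply_eq (he : IsHarmonicONB l e) (he' : IsHarmonicONB l e')
    (x : S2) : ∑ m, ‖e m x‖ ^ 2 = ∑ m, ‖e' m x‖ ^ 2 := by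
  let ι := Submodule.equivMapOfInjective toL2 toL2_injective (sphericalHarmonics l)
  let φ : (sphericalHarmonics l).map toL2 →ₗ[ℂ] ℂ :=
    (ContinuousMap.evalCLM ℂ x).toLinearMap ∘ₗ (sphericalHarmonics l).subtype ∘ₗ ι.symm.toLinearMap
  have hφ {e : Fin (2 * l + 1) → C(S2, ℂ)} (he : IsHarmonicONB l e) (m) :
      φ (he.orthonormalBasis m) = e m x := by
    have hι : ι ⟨e m, (isHarmonicONB_iff_orthonormal.1 he).1 m⟩ = he.orthonormalBasis m := by
      rw [IsHarmonicONB.orthonormalBasis, OrthonormalBasis.coe_mk]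
      rfl
    simp only [φ, ← hι, LinearMap.comp_apply, LinearEquiv.coe_coe, LinearEquiv.symm_apply_apply]
    rfl
  simpa only [hφ] using
    sum_norm_sq_apply_orthonormalBasis he.orthonormalBasis he'.orthonormalBasis φ

theorem IsHarmonicONB.comp_sphereMap (he : IsHarmonicONB l e) (R : E3 ≃ₗᵢ[ℝ] E3) :
    IsHarmonicONB l fun m => (e m).comp (sphereMap R) := by
  refine isHarmonicONB_iff_orthonormal.2 ⟨fun m =>
    comp_sphereMap_mem_sphericalHarmonics ((isHarmonicONB_iff_orthonormal.1 he).1 m) R,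
    orthonormal_toL2_comp_iff.2 fun m n => ?_⟩
  rw [← he.2 m n]
  have hinj : Function.Injective (sphereMap R) := fun x y h =>
    Subtype.ext (R.injective (congrArg Subtype.val h))
  exact (measurePreserving_sphereMap R.measurePreserving).integral_comp
    ((sphereMap R).continuous.measurableEmbedding hinj) fun x => starRingEnd ℂ (e m x) * e n x

theorem IsHarmonicONB.sum_norm_sq_apply_eq_apply (he : IsHarmonicONB l e) (x y : S2) :
    ∑ m, ‖e m x‖ ^ 2 = ∑ m, ‖e m y‖ ^ 2 := by
  obtain ⟨R, rfl⟩ := exists_sphereMap_eq x y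
  exact he.sum_norm_sq_apply_eq (he.comp_sphereMap R) x

theorem integrable_mul_norm_sq (a f : C(S2, ℂ)) :
    Integrable (fun x => a x * ((‖f x‖ ^ 2 : ℝ) : ℂ)) volS2 :=
  Continuous.integrable_of_hasCompactSupport (by fun_prop) (HasCompactSupport.of_compactSpace _)

theorem IsHarmonicONB.integral_norm_sq (he : IsHarmonicONB l e) (m : Fin (2 * l + 1)) :
    ∫ x, ((‖e m x‖ ^ 2 : ℝ) : ℂ) ∂volS2 = 1 := by
  simpa only [Complex.conj_mul', Complex.ofReal_pow, if_true] using he.2 m m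

instance : NeZero volS2 :=
  ⟨Measure.measure_univ_ne_zero.1 (by simpa using Real.pi_pos)⟩

theorem IsHarmonicONB.sum_integral_mul_norm_sq (he : IsHarmonicONB l e) (a : C(S2, ℂ)) :
    ∑ m, ∫ x, a x * ((‖e m x‖ ^ 2 : ℝ) : ℂ) ∂volS2 = (2 * l + 1 : ℕ) * ⨍ x, a x ∂volS2 := by
  obtain ⟨y⟩ : Nonempty S2 := (NormedSpace.sphere_nonempty.2 zero_le_one).to_subtype
  have hsum (a : C(S2, ℂ)) : ∑ m, ∫ x, a x * ((‖e m x‖ ^ 2 : ℝ) : ℂ) ∂volS2 =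
      (∑ m, ‖e m y‖ ^ 2 : ℝ) * ∫ x, a x ∂volS2 := by
    rw [← integral_finsetSum _ fun m _ => integrable_mul_norm_sq a (e m), ← integral_const_mul]
    refine integral_congr_ae (.of_forall fun x => ?_)
    simp only [← Finset.mul_sum, ← Complex.ofReal_sum]
    rw [he.sum_norm_sq_apply_eq_apply x y, mul_comm]
  have hvol : (volS2.real Set.univ : ℂ) ≠ 0 :=
    Complex.ofReal_ne_zero.2 measureReal_univ_ne_zero
  have hone : ((2 * l + 1 : ℕ) : ℂ) = (∑ m, ‖e m y‖ ^ 2 : ℝ) * volS2.real Set.univ := by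
    have h := hsum 1
    simp only [ContinuousMap.one_apply, one_mul, he.integral_norm_sq, Finset.sum_const,
      Finset.card_univ, Fintype.card_fin, nsmul_eq_mul, mul_one, integral_const,
      Complex.real_smul] at h
    exact h
  rw [hsum, average_eq, hone, Complex.real_smul, Complex.ofReal_inv, mul_assoc,
    mul_inv_cancel_left₀ hvol]

end HarmonicONB

section HermitianForms

open scoped Matrix

variable {ι : Type*} [Fintype ι]

/-- The value at `v` of the quadratic form of the Hermitian part of the matrix `A`, since taking
the real part of `v* A v` amounts to replacing `A` by `(A + A*) / 2`. In particular `hermForm 1` is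
the squared Euclidean norm, which the sup norm of `ι → ℂ` does not provide. -/
noncomputable def hermForm (A : Matrix ι ι ℂ) (v : ι → ℂ) : ℝ := (star v ⬝ᵥ (A *ᵥ v)).re

theorem continuous_hermForm (A : Matrix ι ι ℂ) : Continuous (hermForm A) := by
  unfold hermForm dotProduct Matrix.mulVec dotProduct
  fun_prop

theorem hermForm_mulVec (A U : Matrix ι ι ℂ) (v : ι → ℂ) :
    hermForm A (U *ᵥ v) = hermForm (Uᴴ * A * U) v := by
  rw [hermForm, hermForm, Matrix.star_mulVec, ← Matrix.mulVec_mulVec, ← Matrix.mulVec_mulVec,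
    Matrix.dotProduct_mulVec (star v) Uᴴ]

theorem hermForm_smul (A : Matrix ι ι ℂ) (c : ℝ) (v : ι → ℂ) :
    hermForm A (c • v) = c ^ 2 * hermForm A v := by
  simp only [hermForm, Matrix.mulVec_smul, star_smul, star_trivial, smul_dotProduct,
    dotProduct_smul, Complex.smul_re, smul_eq_mul]
  ring

theorem hermForm_sub_smul (A B : Matrix ι ι ℂ) (t : ℝ) (v : ι → ℂ) :
    hermForm (A - t • B) v = hermForm A v - t * hermForm B v := by
  simp only [hermForm, Matrix.sub_mulVec, Matrix.smul_mulVec, dotProduct_sub, dotProduct_smul,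
    Complex.sub_re, Complex.smul_re, smul_eq_mul]

theorem hermForm_conjTranspose (A : Matrix ι ι ℂ) (v : ι → ℂ) : hermForm Aᴴ v = hermForm A v := by
  have h : star v ⬝ᵥ (Aᴴ *ᵥ v) = star (star v ⬝ᵥ (A *ᵥ v)) := by
    rw [Matrix.star_dotProduct, Matrix.star_mulVec, Matrix.conjTranspose_conjTranspose,
      Matrix.dotProduct_mulVec]
  rw [hermForm, hermForm, h, RCLike.star_def, Complex.conj_re]

theorem hermForm_realPart (A : Matrix ι ι ℂ) (v : ι → ℂ) :
    hermForm ((2 : ℝ)⁻¹ • (A + Aᴴ)) v = hermForm A v := by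
  have h := hermForm_conjTranspose A v
  simp only [hermForm, Matrix.add_mulVec, Matrix.smul_mulVec, dotProduct_add, dotProduct_smul,
    Complex.add_re, Complex.smul_re, smul_eq_mul] at h ⊢
  rw [h]
  ring

variable [DecidableEq ι]

theorem hermForm_diagonal (c : ι → ℝ) (v : ι → ℂ) :
    hermForm (Matrix.diagonal fun i => (c i : ℂ)) v = ∑ i, c i * ‖v i‖ ^ 2 := by
  simp only [hermForm, dotProduct, Matrix.mulVec_diagonal, Complex.re_sum, Pi.star_apply]
  refine Finset.sum_congr rfl fun i _ => ?_
  rw [mul_left_comm, Complex.re_ofReal_mul, RCLike.star_def, Complex.conj_mul',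
    ← Complex.ofReal_pow, Complex.ofReal_re]

theorem hermForm_one (v : ι → ℂ) : hermForm 1 v = ∑ i, ‖v i‖ ^ 2 := by
  simpa using hermForm_diagonal (fun _ => 1) v

theorem hermForm_one_nonneg (v : ι → ℂ) : 0 ≤ hermForm 1 v :=
  hermForm_one v ▸ Finset.sum_nonneg fun _ _ => sq_nonneg _

theorem hermForm_one_eq_zero {v : ι → ℂ} : hermForm 1 v = 0 ↔ v = 0 := by
  simp [hermForm_one, Finset.sum_eq_zero_iff_of_nonneg, funext_iff]

theorem hermForm_one_single (m : ι) : hermForm 1 (Pi.single m 1 : ι → ℂ) = 1 := by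
  simp [hermForm]

theorem hermForm_one_ofLp (v : EuclideanSpace ℂ ι) : hermForm 1 v.ofLp = ‖v‖ ^ 2 := by
  rw [hermForm_one, EuclideanSpace.norm_sq_eq]

theorem hermForm_one_mulVec {U : Matrix ι ι ℂ} (hU : U ∈ Matrix.unitaryGroup ι ℂ) (v : ι → ℂ) :
    hermForm 1 (U *ᵥ v) = hermForm 1 v := by
  rw [hermForm_mulVec, mul_one, ← Matrix.star_eq_conjTranspose, Matrix.mem_unitaryGroup_iff'.1 hU]

theorem hermForm_mulVec_eigenvectorUnitary {A : Matrix ι ι ℂ} (hA : A.IsHermitian) (v : ι → ℂ) :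
    hermForm A (hA.eigenvectorUnitary.1 *ᵥ v) = ∑ i, hA.eigenvalues i * ‖v i‖ ^ 2 := by
  rw [hermForm_mulVec, ← hermForm_diagonal, ← Matrix.star_eq_conjTranspose]
  congr 1
  rw [← Unitary.conjStarAlgAut_star_apply (S := ℂ), hA.conjStarAlgAut_star_eigenvectorUnitary]
  rfl

theorem abs_eigenvalues_sub_one_le {A : Matrix ι ι ℂ} (hA : A.IsHermitian) {δ : ℝ}
    (hδ : ∀ v, |hermForm A v - hermForm 1 v| ≤ δ * hermForm 1 v) (i : ι) :
    |hA.eigenvalues i - 1| ≤ δ := by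
  have h := hδ (hA.eigenvectorBasis i).ofLp
  have hA' : hermForm A (hA.eigenvectorBasis i).ofLp = hA.eigenvalues i :=
    (hA.eigenvalues_eq i).symm
  rwa [hA', hermForm_one_ofLp, hA.eigenvectorBasis.orthonormal.1, one_pow, mul_one] at h

theorem exists_unitary_mulVec_single (m : ι) (v : ι → ℂ) :
    ∃ W ∈ Matrix.unitaryGroup ι ℂ, W *ᵥ (√(hermForm 1 v) • Pi.single m 1) = v := by
  by_cases hv : v = 0
  · exact ⟨1, one_mem _, by simp [hv, hermForm_one_eq_zero.2 rfl]⟩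
  set r := √(hermForm 1 v)
  have hr : r = ‖(WithLp.toLp 2 v : EuclideanSpace ℂ ι)‖ := by
    rw [← Real.sqrt_sq (norm_nonneg _), ← hermForm_one_ofLp]
  have hr0 : r ≠ 0 := by
    rw [hr, norm_ne_zero_iff]
    simpa using hv
  set w : EuclideanSpace ℂ ι := r⁻¹ • WithLp.toLp 2 v with hw
  have hunit : ‖w‖ = 1 := by
    rw [hw, norm_smul, norm_inv, ← hr, Real.norm_of_nonneg (Real.sqrt_nonneg _),
      inv_mul_cancel₀ hr0]
  have horth : Orthonormal ℂ (({m} : Set ι).domRestrict fun _ : ι => w) :=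
    ⟨fun _ => hunit, fun i j hij => absurd (Subsingleton.elim i j) hij⟩
  obtain ⟨b, hb⟩ := horth.exists_orthonormalBasis_extension_of_card_eq finrank_euclideanSpace
  refine ⟨_, (EuclideanSpace.basisFun ι ℂ).toMatrix_orthonormalBasis_mem_unitary b, ?_⟩
  have hcol : ((EuclideanSpace.basisFun ι ℂ).toBasis.toMatrix b).col m = r⁻¹ • v := by
    funext i
    simp [Matrix.col, Module.Basis.toMatrix_apply, hb m rfl, hw]
  rw [Matrix.mulVec_smul, Matrix.mulVec_single_one, hcol, smul_smul, mul_inv_cancel₀ hr0, one_smul]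

end HermitianForms

section GaussianIntegral

open scoped Matrix ComplexOrder

variable {ι : Type*} [Fintype ι]

theorem measurable_exp_neg_hermForm (A : Matrix ι ι ℂ) :
    Measurable fun v => ENNReal.ofReal (Real.exp (-hermForm A v)) :=
  (Real.continuous_exp.comp (continuous_hermForm A).neg).measurable.ennreal_ofReal

theorem integral_exp_neg_mul_norm_sq {c : ℝ} (hc : 0 < c) :
    ∫ z : ℂ, Real.exp (-c * ‖z‖ ^ 2) = Real.pi / c := by
  rw [GaussianFourier.integral_rexp_neg_mul_sq_norm hc, Complex.finrank_real_complex]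
  norm_num

theorem lintegral_exp_neg_sum_mul_norm_sq {c : ι → ℝ} (hc : ∀ i, 0 < c i) :
    ∫⁻ v : ι → ℂ, ENNReal.ofReal (Real.exp (-∑ i, c i * ‖v i‖ ^ 2)) =
      ENNReal.ofReal (∏ i, Real.pi / c i) := by
  have hint (i) : Integrable fun z : ℂ => Real.exp (-c i * ‖z‖ ^ 2) :=
    .of_integral_ne_zero (by
      rw [integral_exp_neg_mul_norm_sq (hc i)]
      exact (div_pos Real.pi_pos (hc i)).ne')
  simp only [← integral_exp_neg_mul_norm_sq (hc _), ← Finset.sum_neg_distrib, Real.exp_sum,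
    ← neg_mul]
  rw [← integral_fintype_prod_volume_eq_prod (fun i (z : ℂ) => Real.exp (-c i * ‖z‖ ^ 2)),
    volume_pi, ← ofReal_integral_eq_lintegral_ofReal (.fintype_prod hint)
      (.of_forall fun v => Finset.prod_nonneg fun i _ => (Real.exp_pos _).le)]

variable [DecidableEq ι]

theorem measurePreserving_unitary_mulVec {U : Matrix ι ι ℂ} (hU : U ∈ Matrix.unitaryGroup ι ℂ) :
    MeasurePreserving (fun v : ι → ℂ => U *ᵥ v) volume volume := by
  let f : (ι → ℂ) →ₗ[ℝ] (ι → ℂ) := (Matrix.toLin' U).restrictScalars ℝ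
  have hdet : |LinearMap.det f| = 1 := by
    have hnorm : LinearMap.det f = Algebra.norm ℝ (LinearMap.det (Matrix.toLin' U)) :=
      LinearMap.det_restrictScalars
    have hU1 : ‖U.det‖ = 1 := CStarRing.norm_of_mem_unitary (Matrix.det_of_mem_unitary hU)
    rw [hnorm, LinearMap.det_toLin', Algebra.norm_complex_apply, Complex.normSq_eq_norm_sq, hU1,
      one_pow, abs_one]
  refine ⟨f.continuous_of_finiteDimensional.measurable, ?_⟩
  have h := Measure.map_linearMap_addHaar_eq_smul_addHaar (volume : Measure (ι → ℂ)) (f := f)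
    (abs_ne_zero.1 (hdet ▸ one_ne_zero))
  rwa [abs_inv, hdet, inv_one, ENNReal.ofReal_one, one_smul] at h

theorem lintegral_exp_neg_hermForm {A : Matrix ι ι ℂ} (hA : A.PosDef) :
    ∫⁻ v, ENNReal.ofReal (Real.exp (-hermForm A v)) =
      ENNReal.ofReal (∏ i, Real.pi / hA.isHermitian.eigenvalues i) := by
  rw [← lintegral_exp_neg_sum_mul_norm_sq hA.eigenvalues_pos,
    ← (measurePreserving_unitary_mulVec hA.isHermitian.eigenvectorUnitary.2).lintegral_comp
      (measurable_exp_neg_hermForm A)]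
  simp only [hermForm_mulVec_eigenvectorUnitary]

end GaussianIntegral

section UnitaryColumns

open scoped Matrix ComplexOrder

variable {ι : Type*} [Fintype ι] [DecidableEq ι]

theorem exp_one_sub_le_inv {y : ℝ} (hy : 0 < y) : Real.exp (1 - y) ≤ y⁻¹ := by
  rw [← neg_sub, Real.exp_neg]
  exact inv_anti₀ hy (by linarith [Real.add_one_le_exp (y - 1)])

theorem pi_pow_mul_exp_le_lintegral {y : ℝ} (hy : 0 < y) :
    ENNReal.ofReal (Real.pi ^ Fintype.card ι * Real.exp (Fintype.card ι * (1 - y))) ≤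
      ∫⁻ v : ι → ℂ, ENNReal.ofReal (Real.exp (-(hermForm 1 v * y))) := by
  simp only [hermForm_one, mul_comm _ y, Finset.mul_sum]
  rw [lintegral_exp_neg_sum_mul_norm_sq fun _ => hy, Finset.prod_const, Finset.card_univ,
    div_pow, div_eq_mul_inv, ← inv_pow, Real.exp_nat_mul]
  gcongr
  exact exp_one_sub_le_inv hy

instance : SecondCountableTopology (Matrix.unitaryGroup ι ℂ) :=
  inferInstanceAs (SecondCountableTopology
    {U : ι → ι → ℂ // (U : Matrix ι ι ℂ) ∈ Matrix.unitaryGroup ι ℂ})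

theorem continuous_unitary_mulVec :
    Continuous fun p : Matrix.unitaryGroup ι ℂ × (ι → ℂ) => p.1.1 *ᵥ p.2 :=
  (continuous_subtype_val.comp continuous_fst).matrix_mulVec continuous_snd

theorem continuous_unitary_mulVec_const (v : ι → ℂ) :
    Continuous fun U : Matrix.unitaryGroup ι ℂ => U.1 *ᵥ v :=
  continuous_subtype_val.matrix_mulVec continuous_const

variable [MeasurableSpace (Matrix.unitaryGroup ι ℂ)] [BorelSpace (Matrix.unitaryGroup ι ℂ)]
  (μ : Measure (Matrix.unitaryGroup ι ℂ)) [μ.IsMulRightInvariant]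

theorem lintegral_unitary_mulVec_eq_column (F : (ι → ℂ) → ENNReal) (m : ι) (v : ι → ℂ) :
    ∫⁻ U, F (U.1 *ᵥ v) ∂μ = ∫⁻ U, F (√(hermForm 1 v) • U.1 *ᵥ Pi.single m 1) ∂μ := by
  obtain ⟨W, hW, hWv⟩ := exists_unitary_mulVec_single m v
  refine Eq.trans (lintegral_congr fun U => congrArg F ?_) (lintegral_mul_right_eq_self
    (fun U => F (√(hermForm 1 v) • U.1 *ᵥ Pi.single m 1)) (⟨W, hW⟩ : Matrix.unitaryGroup ι ℂ))
  rw [Matrix.UnitaryGroup.mul_val, ← Matrix.mulVec_mulVec, ← Matrix.mulVec_smul,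
    ← Matrix.mulVec_smul, hWv]

variable [IsProbabilityMeasure μ]

theorem lintegral_lintegral_column {F : (ι → ℂ) → ENNReal} (hF : Measurable F) (m : ι) :
    ∫⁻ v : ι → ℂ, ∫⁻ U, F (√(hermForm 1 v) • U.1 *ᵥ Pi.single m 1) ∂μ = ∫⁻ v, F v :=
  calc ∫⁻ v : ι → ℂ, ∫⁻ U, F (√(hermForm 1 v) • U.1 *ᵥ Pi.single m 1) ∂μ
      = ∫⁻ v : ι → ℂ, ∫⁻ U, F (U.1 *ᵥ v) ∂μ := by
        simp only [lintegral_unitary_mulVec_eq_column μ F m]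
    _ = ∫⁻ U : Matrix.unitaryGroup ι ℂ, ∫⁻ v : ι → ℂ, F (U.1 *ᵥ v) ∂volume ∂μ :=
        (lintegral_lintegral_swap (f := fun (U : Matrix.unitaryGroup ι ℂ) v => F (U.1 *ᵥ v))
          (hF.comp continuous_unitary_mulVec.measurable).aemeasurable).symm
    _ = ∫⁻ _, ∫⁻ v, F v ∂volume ∂μ :=
        lintegral_congr fun U => (measurePreserving_unitary_mulVec U.2).lintegral_comp hF
    _ = ∫⁻ v, F v := by rw [lintegral_const, measure_univ, mul_one]

theorem lintegral_exp_column_le {A : Matrix ι ι ℂ} (hA : A.PosDef) (m : ι) :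
    ∫⁻ U, ENNReal.ofReal (Real.pi ^ Fintype.card ι * Real.exp (Fintype.card ι *
        (1 - hermForm A (U.1 *ᵥ Pi.single m 1)))) ∂μ ≤
      ∫⁻ v, ENNReal.ofReal (Real.exp (-hermForm A v)) := by
  have hpos (U : Matrix.unitaryGroup ι ℂ) : 0 < hermForm A (U.1 *ᵥ Pi.single m 1) := by
    refine hA.re_dotProduct_pos fun h => zero_ne_one (α := ℝ) ?_
    rw [← hermForm_one_single m, ← hermForm_one_mulVec U.2, h, hermForm_one_eq_zero.2 rfl]
  have hcol := continuous_unitary_mulVec_const (Pi.single m 1 : ι → ℂ)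
  rw [← lintegral_lintegral_column μ (measurable_exp_neg_hermForm A) m]
  simp only [hermForm_smul, Real.sq_sqrt (hermForm_one_nonneg _)]
  rw [← lintegral_lintegral_swap]
  · exact lintegral_mono fun U => pi_pow_mul_exp_le_lintegral (hpos U)
  · have hcont : Continuous fun p : Matrix.unitaryGroup ι ℂ × (ι → ℂ) =>
        hermForm 1 p.2 * hermForm A (p.1.1 *ᵥ Pi.single m 1) :=
      ((continuous_hermForm 1).comp continuous_snd).mul
        ((continuous_hermForm A).comp (hcol.comp continuous_fst))
    exact (Real.continuous_exp.comp hcont.neg).measurable.ennreal_ofReal.aemeasurable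

end UnitaryColumns

theorem inv_one_add_le_exp {y : ℝ} (hy : |y| ≤ 1 / 2) : (1 + y)⁻¹ ≤ Real.exp (-y + y ^ 2) := by
  obtain ⟨hy₁, hy₂⟩ := abs_le.1 hy
  have hpos : 0 ≤ 1 + y := by linarith
  rw [inv_le_iff_one_le_mul₀ (by linarith)]
  rcases le_total 0 y with h | h
  · calc (1 : ℝ) ≤ (-y + y ^ 2 + 1) * (1 + y) := by nlinarith [mul_nonneg h (sq_nonneg y)]
      _ ≤ _ := by gcongr; exact Real.add_one_le_exp _
  · have hy₀ : 0 ≤ -y + y ^ 2 := by nlinarith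
    have hq := Real.quadratic_le_exp_of_nonneg hy₀
    have hc : 0 ≤ (1 - y ^ 2) * (1 - y) + 2 * y := by nlinarith [sq_nonneg y]
    calc (1 : ℝ) ≤ (1 + (-y + y ^ 2) + (-y + y ^ 2) ^ 2 / 2) * (1 + y) := by
          nlinarith [mul_nonneg (sq_nonneg y) hc]
      _ ≤ _ := by gcongr

theorem prod_inv_le_exp {ι : Type*} [Fintype ι] {x : ι → ℝ} (hsum : ∑ i, (x i - 1) = 0)
    {δ : ℝ} (hδ : δ ≤ 1 / 2) (hx : ∀ i, |x i - 1| ≤ δ) :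
    ∏ i, (x i)⁻¹ ≤ Real.exp (Fintype.card ι * δ ^ 2) := by
  have hle (i : ι) : (x i)⁻¹ ≤ Real.exp (-(x i - 1) + δ ^ 2) :=
    calc (x i)⁻¹ = (1 + (x i - 1))⁻¹ := by rw [add_sub_cancel]
      _ ≤ Real.exp (-(x i - 1) + (x i - 1) ^ 2) := inv_one_add_le_exp ((hx i).trans hδ)
      _ ≤ Real.exp (-(x i - 1) + δ ^ 2) := by
        rw [← sq_abs (x i - 1)]
        gcongr
        exact hx i
  have hpos (i : ι) : 0 ≤ (x i)⁻¹ := inv_nonneg.2 (by linarith [(abs_le.1 (hx i)).1])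
  calc ∏ i, (x i)⁻¹ ≤ ∏ i, Real.exp (-(x i - 1) + δ ^ 2) :=
        Finset.prod_le_prod (fun i _ => hpos i) fun i _ => hle i
    _ = Real.exp (Fintype.card ι * δ ^ 2) := by
        rw [← Real.exp_sum, Finset.sum_add_distrib, Finset.sum_neg_distrib, hsum, neg_zero,
          zero_add, Finset.sum_const, Finset.card_univ, nsmul_eq_mul]

section ColumnConcentration

open scoped Matrix ComplexOrder

variable {ι : Type*} [Fintype ι] [DecidableEq ι]

theorem posDef_of_abs_hermForm_sub_one_le {A : Matrix ι ι ℂ} (hA : A.IsHermitian) {δ : ℝ}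
    (hδ : δ ≤ 1 / 2) (h : ∀ v, |hermForm A v - hermForm 1 v| ≤ δ * hermForm 1 v) :
    A.PosDef :=
  hA.posDef_iff_eigenvalues_pos.2 fun i => by
    linarith [(abs_le.1 (abs_eigenvalues_sub_one_le hA h i)).1]

theorem lintegral_exp_neg_hermForm_le {A : Matrix ι ι ℂ} (hA : A.IsHermitian)
    (htr : A.trace = Fintype.card ι) {δ : ℝ} (hδ : δ ≤ 1 / 2)
    (h : ∀ v, |hermForm A v - hermForm 1 v| ≤ δ * hermForm 1 v) :
    ∫⁻ v, ENNReal.ofReal (Real.exp (-hermForm A v)) ≤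
      ENNReal.ofReal (Real.pi ^ Fintype.card ι * Real.exp (Fintype.card ι * δ ^ 2)) := by
  have hsum : ∑ i, (hA.eigenvalues i - 1) = 0 := by
    rw [Finset.sum_sub_distrib, Finset.sum_const, Finset.card_univ, nsmul_one, sub_eq_zero]
    refine Complex.ofReal_injective ?_
    rw [Complex.ofReal_sum, Complex.ofReal_natCast, ← htr]
    exact hA.trace_eq_sum_eigenvalues.symm
  rw [lintegral_exp_neg_hermForm (posDef_of_abs_hermForm_sub_one_le hA hδ h)]
  simp only [div_eq_mul_inv, Finset.prod_mul_distrib, Finset.prod_const, Finset.card_univ]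
  gcongr
  exact prod_inv_le_exp hsum hδ (abs_eigenvalues_sub_one_le hA h)

variable [MeasurableSpace (Matrix.unitaryGroup ι ℂ)] [BorelSpace (Matrix.unitaryGroup ι ℂ)]
  (μ : Measure (Matrix.unitaryGroup ι ℂ)) [μ.IsMulRightInvariant] [IsProbabilityMeasure μ]

theorem lintegral_exp_one_sub_column_le {A : Matrix ι ι ℂ} (hA : A.IsHermitian)
    (htr : A.trace = Fintype.card ι) {δ : ℝ} (hδ : δ ≤ 1 / 2)
    (h : ∀ v, |hermForm A v - hermForm 1 v| ≤ δ * hermForm 1 v) (m : ι) :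
    ∫⁻ U, ENNReal.ofReal (Real.exp (Fintype.card ι *
        (1 - hermForm A (U.1 *ᵥ Pi.single m 1)))) ∂μ ≤
      ENNReal.ofReal (Real.exp (Fintype.card ι * δ ^ 2)) := by
  have hle := (lintegral_exp_column_le μ (posDef_of_abs_hermForm_sub_one_le hA hδ h) m).trans
    (lintegral_exp_neg_hermForm_le hA htr hδ h)
  have hpi : 0 < Real.pi ^ Fintype.card ι := by positivity
  simp only [ENNReal.ofReal_mul hpi.le] at hle
  rw [lintegral_const_mul' _ _ ENNReal.ofReal_ne_top] at hle
  exact (ENNReal.mul_le_mul_iff_right (ENNReal.ofReal_pos.2 hpi).ne' ENNReal.ofReal_ne_top).1 hle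

theorem lintegral_exp_mul_hermForm_column_le {H : Matrix ι ι ℂ} (hH : H.IsHermitian)
    (htr : H.trace = 0) {K : ℝ} (hbd : ∀ v, |hermForm H v| ≤ K * hermForm 1 v) {t : ℝ}
    (ht : 0 ≤ t) (htK : t * K ≤ 1 / 2) (m : ι) :
    ∫⁻ U, ENNReal.ofReal (Real.exp (Fintype.card ι *
        (t * hermForm H (U.1 *ᵥ Pi.single m 1)))) ∂μ ≤
      ENNReal.ofReal (Real.exp (Fintype.card ι * (t * K) ^ 2)) := by
  have hA : (1 - t • H).IsHermitian := Matrix.isHermitian_one.sub (hH.smul (IsSelfAdjoint.all t))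
  have htrA : (1 - t • H).trace = Fintype.card ι := by
    rw [Matrix.trace_sub, Matrix.trace_one, Matrix.trace_smul, htr, smul_zero, sub_zero]
  have hbdA (v : ι → ℂ) :
      |hermForm (1 - t • H) v - hermForm 1 v| ≤ t * K * hermForm 1 v := by
    rw [hermForm_sub_smul, sub_sub_cancel_left, abs_neg, abs_mul, abs_of_nonneg ht, mul_assoc]
    exact mul_le_mul_of_nonneg_left (hbd v) ht
  have hone (U : Matrix.unitaryGroup ι ℂ) : hermForm 1 (U.1 *ᵥ Pi.single m 1) = 1 := by
    rw [hermForm_one_mulVec U.2, hermForm_one_single]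
  simpa only [hermForm_sub_smul, hone, sub_sub_cancel] using
    lintegral_exp_one_sub_column_le μ hA htrA htK hbdA m

theorem measure_le_hermForm_column_le_of_isHermitian {H : Matrix ι ι ℂ}
    (hH : H.IsHermitian) (htr : H.trace = 0) {K : ℝ} (hK : 0 < K)
    (hbd : ∀ v, |hermForm H v| ≤ K * hermForm 1 v) {s : ℝ} (hs₀ : 0 ≤ s) (hsK : s ≤ K) (m : ι) :
    μ {U | s ≤ hermForm H (U.1 *ᵥ Pi.single m 1)} ≤
      ENNReal.ofReal (Real.exp (-(Fintype.card ι * s ^ 2 / (4 * K ^ 2)))) := by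
  -- The exponent `n ((t K)² - t s)` of the Chernoff bound is minimal at this `t`.
  set t : ℝ := s / (2 * K ^ 2) with ht
  set n : ℝ := (Fintype.card ι : ℝ)
  have ht₀ : 0 ≤ t := by positivity
  have htK : t * K ≤ 1 / 2 := by
    rw [ht, div_mul_eq_mul_div, div_le_iff₀ (by positivity)]
    nlinarith
  have hmeas : Measurable fun U : Matrix.unitaryGroup ι ℂ => ENNReal.ofReal
      (Real.exp (n * (t * hermForm H (U.1 *ᵥ Pi.single m 1)))) := by
    have hcont := (continuous_hermForm H).comp
      (continuous_unitary_mulVec_const (Pi.single m 1 : ι → ℂ))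
    exact (Real.continuous_exp.comp
      (continuous_const.mul (continuous_const.mul hcont))).measurable.ennreal_ofReal
  calc μ {U | s ≤ hermForm H (U.1 *ᵥ Pi.single m 1)}
      ≤ μ {U | ENNReal.ofReal (Real.exp (n * (t * s))) ≤
          ENNReal.ofReal (Real.exp (n * (t * hermForm H (U.1 *ᵥ Pi.single m 1))))} := by
        refine measure_mono fun U (hU : s ≤ _) => ENNReal.ofReal_le_ofReal ?_
        gcongr
    _ ≤ ENNReal.ofReal (Real.exp (n * (t * K) ^ 2)) / ENNReal.ofReal (Real.exp (n * (t * s))) :=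
        (meas_ge_le_lintegral_div hmeas.aemeasurable (ENNReal.ofReal_pos.2 (Real.exp_pos _)).ne'
          ENNReal.ofReal_ne_top).trans (ENNReal.div_le_div_right
            (lintegral_exp_mul_hermForm_column_le μ hH htr hbd ht₀ htK m) _)
    _ = ENNReal.ofReal (Real.exp (-(n * s ^ 2 / (4 * K ^ 2)))) := by
        rw [← ENNReal.ofReal_div_of_pos (Real.exp_pos _), ← Real.exp_sub, ht]
        congr 2
        field_simp
        ring

theorem measure_le_hermForm_column_le {A : Matrix ι ι ℂ} (htr : A.trace = 0) {K : ℝ} (hK : 0 < K)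
    (hbd : ∀ v, |hermForm A v| ≤ K * hermForm 1 v) {s : ℝ} (hs₀ : 0 ≤ s) (hsK : s ≤ K) (m : ι) :
    μ {U | s ≤ hermForm A (U.1 *ᵥ Pi.single m 1)} ≤
      ENNReal.ofReal (Real.exp (-(Fintype.card ι * s ^ 2 / (4 * K ^ 2)))) := by
  have hH : ((2 : ℝ)⁻¹ • (A + Aᴴ)).IsHermitian :=
    (Matrix.isHermitian_add_transpose_self A).smul (IsSelfAdjoint.all _)
  have htrH : ((2 : ℝ)⁻¹ • (A + Aᴴ)).trace = 0 := by
    rw [Matrix.trace_smul, Matrix.trace_add, Matrix.trace_conjTranspose, htr, star_zero, add_zero,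
      smul_zero]
  simpa only [hermForm_realPart] using measure_le_hermForm_column_le_of_isHermitian μ hH htrH hK
    (fun v => (congrArg abs (hermForm_realPart A v)).trans_le (hbd v)) hs₀ hsK m

end ColumnConcentration

section HaarUnitary

instance (l : ℕ) : (haarUnitary l).IsHaarMeasure := by
  unfold haarUnitary
  infer_instance

instance (l : ℕ) : (haarUnitary l).IsMulRightInvariant :=
  ⟨fun W => by
    have : IsProbabilityMeasure ((haarUnitary l).map (· * W)) :=
      Measure.isProbabilityMeasure_map (continuous_mul_const W).measurable.aemeasurable
    exact Measure.isHaarMeasure_eq_of_isProbabilityMeasure _ _⟩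

end HaarUnitary

section Expectation

open scoped Matrix

variable {l : ℕ} {e : Fin (2 * l + 1) → C(S2, ℂ)}

/-- The quantum expectation `⟨f, β f⟩` of the observable `β` in the state `f`. -/
noncomputable def expectationS2 (β f : C(S2, ℂ)) : ℂ := ∫ x, β x * ((‖f x‖ ^ 2 : ℝ) : ℂ) ∂volS2

theorem inner_toL2_mul (β f : C(S2, ℂ)) :
    inner ℂ (toL2 f) (toL2 (β * f)) = expectationS2 β f := by
  rw [inner_toL2, expectationS2]
  refine integral_congr_ae (.of_forall fun x => ?_)
  simp only [ContinuousMap.mul_apply, Complex.ofReal_pow, ← Complex.conj_mul', mul_left_comm]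

theorem continuous_expectationS2 (β : C(S2, ℂ)) : Continuous (expectationS2 β) := by
  simp only [← funext (inner_toL2_mul β)]
  exact continuous_toL2.inner (continuous_toL2.comp (continuous_const.mul continuous_id))

theorem expectationS2_smul (w : ℂ) (β f : C(S2, ℂ)) :
    expectationS2 (w • β) f = w * expectationS2 β f := by
  simp only [expectationS2, ContinuousMap.smul_apply, smul_eq_mul, mul_assoc, integral_const_mul]

theorem IsHarmonicONB.expectationS2_sub_const (he : IsHarmonicONB l e) (m : Fin (2 * l + 1))
    (a : C(S2, ℂ)) (z : ℂ) :
    expectationS2 (a - ContinuousMap.const S2 z) (e m) = expectationS2 a (e m) - z := by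
  have hz : ∫ x, z * ((‖e m x‖ ^ 2 : ℝ) : ℂ) ∂volS2 = z := by
    rw [integral_const_mul, he.integral_norm_sq, mul_one]
  simp only [expectationS2, ContinuousMap.sub_apply, sub_mul]
  rw [integral_sub (integrable_mul_norm_sq a (e m))
    (integrable_mul_norm_sq (ContinuousMap.const S2 z) (e m))]
  exact congrArg _ hz

theorem norm_expectationS2_le (β f : C(S2, ℂ)) :
    ‖expectationS2 β f‖ ≤ ‖β‖ * ‖toL2 f‖ ^ 2 := by
  have hint : Integrable (fun x => ‖f x‖ ^ 2) volS2 :=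
    Continuous.integrable_of_hasCompactSupport (by fun_prop) (HasCompactSupport.of_compactSpace _)
  have hnorm : ∫ x, ‖f x‖ ^ 2 ∂volS2 = ‖toL2 f‖ ^ 2 := by
    refine Complex.ofReal_injective ?_
    rw [← integral_complex_ofReal, Complex.ofReal_pow]
    refine Eq.trans ?_ (inner_self_eq_norm_sq_to_K (𝕜 := ℂ) (toL2 f))
    rw [inner_toL2]
    simp only [Complex.conj_mul', Complex.ofReal_pow]
  calc ‖expectationS2 β f‖ ≤ ∫ x, ‖β x * ((‖f x‖ ^ 2 : ℝ) : ℂ)‖ ∂volS2 :=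
        norm_integral_le_integral_norm _
    _ ≤ ∫ x, ‖β‖ * ‖f x‖ ^ 2 ∂volS2 := by
        refine integral_mono (integrable_mul_norm_sq β f).norm (hint.const_mul _) fun x => ?_
        simp only [norm_mul, Complex.norm_real, norm_pow, norm_norm]
        gcongr
        exact β.norm_coe_le_norm x
    _ = ‖β‖ * ‖toL2 f‖ ^ 2 := by rw [integral_const_mul, hnorm]

/-- The matrix, in the family `e`, of the compression to its span of the multiplication by `β`. -/
noncomputable def observableMatrix {ι : Type*} (β : C(S2, ℂ)) (e : ι → C(S2, ℂ)) : Matrix ι ι ℂ :=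
  .of fun i j => inner ℂ (toL2 (e i)) (toL2 (β * e j))

theorem hermForm_observableMatrix {ι : Type*} [Fintype ι] (β : C(S2, ℂ)) (e : ι → C(S2, ℂ))
    (v : ι → ℂ) :
    hermForm (observableMatrix β e) v = (expectationS2 β (∑ j, v j • e j)).re := by
  rw [hermForm, ← inner_toL2_mul, Finset.mul_sum, map_sum, map_sum, sum_inner]
  simp only [dotProduct, Matrix.mulVec, observableMatrix, Matrix.of_apply, inner_sum,
    mul_smul_comm, map_smul, inner_smul_left, inner_smul_right, Pi.star_apply, RCLike.star_def,
    Finset.mul_sum, mul_left_comm (v _), mul_comm (v _)]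

theorem IsHarmonicONB.trace_observableMatrix (he : IsHarmonicONB l e) (β : C(S2, ℂ)) :
    (observableMatrix β e).trace = (2 * l + 1 : ℕ) * ⨍ x, β x ∂volS2 := by
  rw [← he.sum_integral_mul_norm_sq]
  exact Finset.sum_congr rfl fun m _ => inner_toL2_mul β (e m)

theorem IsHarmonicONB.norm_toL2_sum_sq (he : IsHarmonicONB l e) (v : Fin (2 * l + 1) → ℂ) :
    ‖toL2 (∑ j, v j • e j)‖ ^ 2 = hermForm 1 v := by
  have ho := (isHarmonicONB_iff_orthonormal.1 he).2
  rw [hermForm_one, ← inner_self_eq_norm_sq (𝕜 := ℂ), map_sum]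
  simp only [map_smul]
  rw [show (fun j => v j • toL2 (e j)) = fun j => v j • (toL2 ∘ e) j from rfl, ho.inner_sum]
  simp only [Complex.conj_mul', map_sum]
  norm_cast

theorem IsHarmonicONB.abs_hermForm_observableMatrix_le (he : IsHarmonicONB l e) (β : C(S2, ℂ))
    (v : Fin (2 * l + 1) → ℂ) :
    |hermForm (observableMatrix β e) v| ≤ ‖β‖ * hermForm 1 v := by
  rw [hermForm_observableMatrix, ← he.norm_toL2_sum_sq]
  exact (Complex.abs_re_le_norm _).trans (norm_expectationS2_le β _)

theorem HarmonicONB.rotate_apply (b₀ : HarmonicONB l) (U : UnitaryS2 l) (m : Fin (2 * l + 1)) :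
    (b₀.rotate U).1 m = ∑ j, (U.1 *ᵥ Pi.single m 1) j • b₀.1 j := by
  rw [Matrix.mulVec_single_one]
  rfl

theorem haarONB_le_re_expectationS2_le (b₀ : HarmonicONB l) {β : C(S2, ℂ)}
    (hmean : ⨍ x, β x ∂volS2 = 0) {K : ℝ} (hβ : ‖β‖ ≤ K) (hK : 0 < K) {s : ℝ} (hs₀ : 0 ≤ s)
    (hsK : s ≤ K) (m : Fin (2 * l + 1)) :
    haarONB b₀ {b | s ≤ (expectationS2 β (b.1 m)).re} ≤
      ENNReal.ofReal (Real.exp (-((2 * l + 1 : ℕ) * s ^ 2 / (4 * K ^ 2)))) := by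
  have hcont : Continuous fun b : HarmonicONB l => (expectationS2 β (b.1 m)).re :=
    Complex.continuous_re.comp ((continuous_expectationS2 β).comp
      ((continuous_apply m).comp continuous_subtype_val))
  have htr : (observableMatrix β b₀.1).trace = 0 := by
    rw [b₀.2.trace_observableMatrix, hmean, mul_zero]
  have hbd (v : Fin (2 * l + 1) → ℂ) :
      |hermForm (observableMatrix β b₀.1) v| ≤ K * hermForm 1 v :=
    (b₀.2.abs_hermForm_observableMatrix_le β v).trans
      (mul_le_mul_of_nonneg_right hβ (hermForm_one_nonneg v))
  have htail := measure_le_hermForm_column_le (haarUnitary l) htr hK hbd hs₀ hsK m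
  simp only [hermForm_observableMatrix, ← HarmonicONB.rotate_apply, Fintype.card_fin] at htail
  rwa [haarONB, Measure.map_apply b₀.continuous_rotate.measurable
    (isClosed_le continuous_const hcont).measurableSet]

theorem exists_half_le_re_of_le_norm {z : ℂ} {r : ℝ} (hz : r ≤ ‖z‖) :
    ∃ k : Fin 4, r / 2 ≤ (Complex.I ^ (k : ℕ) * z).re := by
  by_contra! h
  have h₀ : z.re < r / 2 := by simpa using h 0
  have h₁ : -z.im < r / 2 := by simpa using h 1
  have h₂ : -z.re < r / 2 := by simpa using h 2
  have h₃ : z.im < r / 2 := by simpa [Complex.I_pow_three] using h 3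
  have hre : |z.re| < r / 2 := abs_lt.2 ⟨by linarith, h₀⟩
  have him : |z.im| < r / 2 := abs_lt.2 ⟨by linarith, h₃⟩
  linarith [Complex.norm_le_abs_re_add_abs_im z]

theorem haarONB_le_norm_expectationS2_le (b₀ : HarmonicONB l) {β : C(S2, ℂ)}
    (hmean : ⨍ x, β x ∂volS2 = 0) {K : ℝ} (hβ : ‖β‖ ≤ K) (hK : 0 < K) {r : ℝ} (hr₀ : 0 ≤ r)
    (hrK : r / 2 ≤ K) (m : Fin (2 * l + 1)) :
    haarONB b₀ {b | r ≤ ‖expectationS2 β (b.1 m)‖} ≤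
      4 * ENNReal.ofReal (Real.exp (-((2 * l + 1 : ℕ) * (r / 2) ^ 2 / (4 * K ^ 2)))) := by
  have hmeanI (k : Fin 4) : ⨍ x, (Complex.I ^ (k : ℕ) • β) x ∂volS2 = 0 := by
    simp only [ContinuousMap.smul_apply, average_eq, integral_smul] at hmean ⊢
    rw [smul_comm, hmean, smul_zero]
  have hβI (k : Fin 4) : ‖Complex.I ^ (k : ℕ) • β‖ ≤ K := by
    rwa [norm_smul, norm_pow, Complex.norm_I, one_pow, one_mul]
  calc haarONB b₀ {b | r ≤ ‖expectationS2 β (b.1 m)‖}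
      ≤ haarONB b₀ (⋃ k : Fin 4,
          {b | r / 2 ≤ (expectationS2 (Complex.I ^ (k : ℕ) • β) (b.1 m)).re}) :=
        measure_mono fun b (hb : r ≤ _) => by
          obtain ⟨k, hk⟩ := exists_half_le_re_of_le_norm hb
          rw [← expectationS2_smul] at hk
          exact Set.mem_iUnion.2 ⟨k, hk⟩
    _ ≤ ∑ _k : Fin 4,
          ENNReal.ofReal (Real.exp (-((2 * l + 1 : ℕ) * (r / 2) ^ 2 / (4 * K ^ 2)))) :=
        (measure_iUnion_fintype_le _ _).trans <| Finset.sum_le_sum fun k _ =>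
          haarONB_le_re_expectationS2_le b₀ (hmeanI k) (hβI k) hK (by positivity) hrK m
    _ = _ := by rw [Finset.sum_const, Finset.card_fin, nsmul_eq_mul, Nat.cast_ofNat]

end Expectation

section Concentration

theorem integrable_volS2 (a : C(S2, ℂ)) : Integrable a volS2 :=
  a.continuous.integrable_of_hasCompactSupport (HasCompactSupport.of_compactSpace _)

theorem norm_average_volS2_le (a : C(S2, ℂ)) : ‖⨍ x, a x ∂volS2‖ ≤ ‖a‖ := by
  rw [← mem_closedBall_zero_iff]
  exact (convex_closedBall 0 ‖a‖).average_mem Metric.isClosed_closedBall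
    (.of_forall fun x => mem_closedBall_zero_iff.2 (a.norm_coe_le_norm x)) (integrable_volS2 a)

/-- The deviation of the observable `a` from its mean over the sphere. -/
noncomputable def centeredS2 (a : C(S2, ℂ)) : C(S2, ℂ) :=
  a - ContinuousMap.const S2 (⨍ x, a x ∂volS2)

theorem average_centeredS2 (a : C(S2, ℂ)) : ⨍ x, centeredS2 a x ∂volS2 = 0 := by
  rw [average_eq]
  exact (congrArg _ (integral_sub_average volS2 a)).trans (smul_zero _)

theorem norm_centeredS2_le (a : C(S2, ℂ)) : ‖centeredS2 a‖ ≤ 2 * ‖a‖ := by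
  have hconst : ‖ContinuousMap.const S2 (⨍ x, a x ∂volS2)‖ ≤ ‖a‖ :=
    (ContinuousMap.norm_le _ (norm_nonneg a)).2 fun _ => norm_average_volS2_le a
  exact (norm_sub_le_of_le le_rfl hconst).trans_eq (two_mul _).symm

theorem haarONB_le_iSup_norm_sub_average_le {l : ℕ} (b₀ : HarmonicONB l) (a : C(S2, ℂ)) {K : ℝ}
    (ha : 2 * ‖a‖ ≤ K) (hK : 0 < K) {r : ℝ} (hr₀ : 0 ≤ r) (hrK : r / 2 ≤ K) :
    haarONB b₀ {b | r ≤ ⨆ m, ‖expectationS2 a (b.1 m) - ⨍ x, a x ∂volS2‖} ≤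
      ENNReal.ofReal (4 * (2 * l + 1 : ℕ) *
        Real.exp (-((2 * l + 1 : ℕ) * (r / 2) ^ 2 / (4 * K ^ 2)))) := by
  have hβ := (norm_centeredS2_le a).trans ha
  calc haarONB b₀ {b | r ≤ ⨆ m, ‖expectationS2 a (b.1 m) - ⨍ x, a x ∂volS2‖}
      ≤ haarONB b₀ (⋃ m, {b | r ≤ ‖expectationS2 (centeredS2 a) (b.1 m)‖}) :=
        measure_mono fun b (hb : r ≤ _) => by
          obtain ⟨m, hm⟩ := exists_eq_ciSup_of_finite
            (f := fun m => ‖expectationS2 a (b.1 m) - ⨍ x, a x ∂volS2‖)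
          rw [← hm, ← b.2.expectationS2_sub_const] at hb
          exact Set.mem_iUnion.2 ⟨m, hb⟩
    _ ≤ ∑ _m : Fin (2 * l + 1), 4 * ENNReal.ofReal
          (Real.exp (-((2 * l + 1 : ℕ) * (r / 2) ^ 2 / (4 * K ^ 2)))) :=
        (measure_iUnion_fintype_le _ _).trans <| Finset.sum_le_sum fun m _ =>
          haarONB_le_norm_expectationS2_le b₀ (average_centeredS2 a) hβ hK hr₀ hrK m
    _ = _ := by
        rw [Finset.sum_const, Finset.card_fin, nsmul_eq_mul, mul_left_comm, mul_assoc,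
          ENNReal.ofReal_mul zero_le_four, ENNReal.ofReal_mul (Nat.cast_nonneg _),
          ENNReal.ofReal_natCast, ENNReal.ofReal_ofNat]

end Concentration

theorem sqrt_le_mul_rpow_neg_eighth_sq {x : ℝ} (hx : 1 ≤ x) :
    √x ≤ x * (x ^ (-(1 / 8) : ℝ)) ^ 2 := by
  have hx₀ : 0 < x := zero_lt_one.trans_le hx
  calc √x = x ^ (1 / 2 : ℝ) := Real.sqrt_eq_rpow x
    _ ≤ x ^ (1 + -(1 / 8) * (2 : ℕ) : ℝ) :=
        Real.rpow_le_rpow_of_exponent_le hx (by norm_num)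
    _ = x * (x ^ (-(1 / 8) : ℝ)) ^ 2 := by
        rw [Real.rpow_add hx₀, Real.rpow_one, Real.rpow_mul_natCast hx₀.le]

theorem le_two_div_sq_mul_exp_mul_sqrt {c x : ℝ} (hc : 0 < c) (hx : 0 ≤ x) :
    x ≤ 2 / c ^ 2 * Real.exp (c * √x) := by
  have hcx : 0 ≤ c * √x := by positivity
  have hexp := Real.quadratic_le_exp_of_nonneg hcx
  rw [mul_pow, Real.sq_sqrt hx] at hexp
  rw [div_mul_eq_mul_div, le_div_iff₀ (by positivity)]
  linarith

theorem four_mul_exp_le {l : ℕ} (hl : 1 ≤ l) {K : ℝ} (hK : 0 < K) :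
    4 * (2 * l + 1 : ℕ) * Real.exp (-((2 * l + 1 : ℕ) *
        ((l : ℝ) ^ (-(1 / 8) : ℝ) / 2) ^ 2 / (4 * K ^ 2))) ≤
      (16 / (1 / (16 * K ^ 2)) ^ 2 + 4) * Real.exp (-(1 / (16 * K ^ 2) * √l)) := by
  set c : ℝ := 1 / (16 * K ^ 2) with hc
  set r : ℝ := (l : ℝ) ^ (-(1 / 8) : ℝ)
  have hc₀ : 0 < c := by positivity
  have hexp : 2 * (c * √l) ≤ (2 * l + 1 : ℕ) * (r / 2) ^ 2 / (4 * K ^ 2) :=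
    calc 2 * (c * √l) ≤ 2 * (c * (l * r ^ 2)) := by
          gcongr
          exact sqrt_le_mul_rpow_neg_eighth_sq (by exact_mod_cast hl)
      _ ≤ (2 * l + 1) * (c * r ^ 2) := by linarith [mul_nonneg hc₀.le (sq_nonneg r)]
      _ = (2 * l + 1 : ℕ) * (r / 2) ^ 2 / (4 * K ^ 2) := by
          rw [hc]
          push_cast
          field_simp
          ring
  have hcard : 4 * (2 * l + 1 : ℕ) ≤ (16 / c ^ 2 + 4) * Real.exp (c * √l) :=
    calc (4 * (2 * l + 1 : ℕ) : ℝ) = 8 * l + 4 * 1 := by push_cast; ring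
      _ ≤ 8 * (2 / c ^ 2 * Real.exp (c * √l)) + 4 * Real.exp (c * √l) := by
          gcongr
          · exact le_two_div_sq_mul_exp_mul_sqrt hc₀ (Nat.cast_nonneg l)
          · exact Real.one_le_exp (by positivity)
      _ = (16 / c ^ 2 + 4) * Real.exp (c * √l) := by ring
  calc _ ≤ (16 / c ^ 2 + 4) * Real.exp (c * √l) * Real.exp (-(2 * (c * √l))) := by gcongr
    _ = (16 / c ^ 2 + 4) * Real.exp (-(c * √l)) := by
        rw [mul_assoc, ← Real.exp_add]
        ring_nf

theorem theoremt (a : C(S2, ℂ)) :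
    ∃ C : ℝ, 0 < C ∧ ∃ c : ℝ, 0 < c ∧ ∀ l : ℕ,
      Nonempty (HarmonicONB l) ∧
      ∀ b₀ : HarmonicONB l,
        haarONB b₀ {b : HarmonicONB l |
          (l : ℝ) ^ (-(1 / 8) : ℝ) ≤
            ⨆ m : Fin (2 * l + 1),
              ‖(∫ x, a x * ((‖b.1 m x‖ ^ 2 : ℝ) : ℂ) ∂volS2) - ⨍ x, a x ∂volS2‖}
          ≤ ENNReal.ofReal (C * Real.exp (-(c * Real.sqrt l))) := by
  set K : ℝ := 2 * ‖a‖ + 1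
  have hK : 1 ≤ K := le_add_of_nonneg_left (by positivity)
  refine ⟨16 / (1 / (16 * K ^ 2)) ^ 2 + 4, by positivity, 1 / (16 * K ^ 2), by positivity,
    fun l => ⟨inferInstance, fun b₀ => ?_⟩⟩
  rcases Nat.eq_zero_or_pos l with rfl | hl
  · refine prob_le_one.trans (ENNReal.one_le_ofReal.2 ?_)
    have hC : 0 ≤ 16 / (1 / (16 * K ^ 2)) ^ 2 := by positivity
    rw [Nat.cast_zero, Real.sqrt_zero, mul_zero, neg_zero, Real.exp_zero, mul_one]
    linarith
  · have hr : (l : ℝ) ^ (-(1 / 8) : ℝ) ≤ 1 :=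
      Real.rpow_le_one_of_one_le_of_nonpos (by exact_mod_cast hl) (by norm_num)
    exact (haarONB_le_iSup_norm_sub_average_le b₀ a (le_add_of_nonneg_right zero_le_one)
      (by positivity) (by positivity) (by linarith)).trans
        (ENNReal.ofReal_le_ofReal (four_mul_exp_le hl (by positivity)))
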